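/- Let $\Delta$ be the open unit disk and let $\tilde G$ be the universal covering group of $PSU(1,1)$, realized as the set of pairs $(g,A)$ with $g=\begin{pmatrix}a&b\\ \bar b&\bar a\end{pmatrix}\in SU(1,1)$, $A\in\mathbb C$, $e^A=a$, with product $(g_1,A_1)(g_2,A_2)=(g_1g_2,\;A_1+A_2+\log(1+\tfrac{b_1\bar b_2}{a_1a_2}))$. For real $m$ let $H^m$ be the space of holomorphic differentials $f(z)(dz)^m$ on $\Delta$, with the topology of uniform convergence on compact sets and its Borel structure, on which $\tilde G$ acts by $$f(z)(dz)^m\mapsto f\Big(\frac{\bar az-b}{-\bar bz+a}\Big)(-\bar bz+a)^{-2m}(dz)^m,\qquad (-\bar bz+a)^{-2m}:=e^{-2mA}\Big(1-\frac{\bar b}{a}z\Big)^{-2m}.$$ An \emph{ergodic invariant measure} on $H^m$ is a $\tilde G$-invariant Borel probability measure such that every Borel set which is almost everywhere invariant under each element of $\tilde G$ has measure $0$ or $1$. The formal completion $H^k_{formal}$ consists of the $f(z)(dz)^k$ with $f$ a formal power series, with the product Borel structure on the coefficients. For $g\in\tilde G$ and $F\in H^k_{formal}$ say that $gF$ is defined,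 and equal to $F'$, if $F$ is the Taylor series at $0$ of a meromorphic differential $\varphi$ of degree $k$ on $\Delta$ that is regular at $0$, and $g\varphi$ (given by the same formula) is regular at $0$ with Taylor series $F'$. A Borel probability measure $\rho$ on $H^k_{formal}$ is called ergodic invariant if for each $g\in\tilde G$ the element $gF$ is defined for $\rho$-almost every $F$ and $F\mapsto gF$ preserves $\rho$ (that is, it agrees almost everywhere with a measurable, $\rho$-preserving map), and if every Borel set $E$ such that, for each $g$, $(gF\in E\iff F\in E)$ for almost every $F$, has measure $0$ or $1$. \textbf{Proposition.} Let $m,n$ be real numbers. (a) If $\nu$ and $\mu$ are ergodic invariant measures on $H^m$, then the convolution $\nu*\mu$ (the image of $\nu\times\mu$ under addition) is an ergodic invariant measure on $H^m$. Let now $\nu$ and $\mu$ be ergodic invariant measures on $H^m$ and $H^n$, respectively. (b) The multiplicative image $\nu\otimes\mu$, i.e. the image of $\nu\times\mu$ under $(f(dz)^m,g(dz)^n)\mapsto fg\,(dz)^{m+n}$, is an ergodic invariant measure on $H^{m+n}$. (c) If $\mu$-almost every $g(dz)^n$ has no zeros in $\Delta$, then the quotient image $Q_*(\nu\times\mu)$,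 where $Q(f(dz)^m,g(dz)^n)=\frac fg(dz)^{m-n}$, is an ergodic invariant measure on $H^{m-n}$. (d) If $g(0)\neq0$ for $\mu$-almost every $g(dz)^n$, then the quotient image $Q_*(\nu\times\mu)$ on $H^{m-n}_{formal}$, where $f/g$ is the quotient of the Taylor series at $0$, is an ergodic invariant measure on $H^{m-n}_{formal}$. -/

import Mathlib

open MeasureTheory
open scoped ComplexConjugate Complex.UnitDisc

noncomputable section

namespace ConformalMeasures

/-! ### The universal covering group of `PSU(1,1)` -/

/-- The universal covering group of `PSU(1,1)`: pairs consisting of a matrix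
`(a, b; conj b, conj a)` in `SU(1,1)` and a logarithm `A` of its entry `a`. -/
@[ext]
structure CoverGroup where
  a : ℂ
  b : ℂ
  A : ℂ
  det_eq_one : a * conj a - b * conj b = 1
  exp_A : Complex.exp A = a

namespace CoverGroup

variable (g h k : CoverGroup)

lemma a_ne_zero : g.a ≠ 0 := by
  rw [← g.exp_A]; exact Complex.exp_ne_zero _

lemma norm_sq_sub : ‖g.a‖ ^ 2 - ‖g.b‖ ^ 2 = 1 := by
  have h := g.det_eq_one
  rw [Complex.mul_conj, Complex.mul_conj, Complex.normSq_eq_norm_sq,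
    Complex.normSq_eq_norm_sq] at h
  exact_mod_cast h

lemma norm_b_lt : ‖g.b‖ < ‖g.a‖ := by
  nlinarith [g.norm_sq_sub, norm_nonneg g.a, norm_nonneg g.b]

lemma norm_div_lt : ‖conj g.b / g.a‖ < 1 := by
  rw [norm_div, RCLike.norm_conj, div_lt_one (norm_pos_iff.2 g.a_ne_zero)]
  exact g.norm_b_lt

lemma norm_div_mul_lt {z : ℂ} (hz : ‖z‖ ≤ 1) : ‖conj g.b / g.a * z‖ < 1 := by
  rw [norm_mul]
  nlinarith [g.norm_div_lt, norm_nonneg (conj g.b / g.a), norm_nonneg z]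

lemma re_one_add_pos {w : ℂ} (hw : ‖w‖ < 1) : 0 < (1 + w).re := by
  have := (abs_le.1 (Complex.abs_re_le_norm w)).1
  simp only [Complex.add_re, Complex.one_re]; linarith

lemma re_one_sub_pos {w : ℂ} (hw : ‖w‖ < 1) : 0 < (1 - w).re := by
  have := (abs_le.1 (Complex.abs_re_le_norm w)).2
  simp only [Complex.sub_re, Complex.one_re]; linarith

lemma ne_zero_of_re_pos {w : ℂ} (hw : 0 < w.re) : w ≠ 0 := by
  rintro rfl; simp at hw

lemma abs_log_im_lt {w : ℂ} (hw : 0 < w.re) : |(Complex.log w).im| < Real.pi / 2 := by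
  rw [Complex.log_im]; exact Complex.abs_arg_lt_pi_div_two_iff.2 (Or.inl hw)

lemma eq_of_exp_eq {p q : ℂ} (h : Complex.exp p = Complex.exp q)
    (him : |p.im - q.im| < 2 * Real.pi) : p = q := by
  obtain ⟨n, hn⟩ := Complex.exp_eq_exp_iff_exists_int.1 h
  have h1 : p.im - q.im = n * (2 * Real.pi) := by
    have := congrArg Complex.im hn
    simp at this
    linarith
  have hn0 : n = 0 := by
    rw [h1, abs_mul, abs_of_pos (by positivity : (0:ℝ) < 2 * Real.pi)] at him
    have : |(n : ℝ)| < 1 := by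
      by_contra hc
      push Not at hc
      nlinarith [Real.pi_pos]
    have h2 : |n| < 1 := by exact_mod_cast this
    exact Int.abs_lt_one_iff.1 h2
  simpa [hn0] using hn

lemma norm_cross_lt : ‖g.b * conj h.b / (g.a * h.a)‖ < 1 := by
  rw [norm_div, norm_mul, norm_mul, RCLike.norm_conj,
    div_lt_one (mul_pos (norm_pos_iff.2 g.a_ne_zero) (norm_pos_iff.2 h.a_ne_zero))]
  nlinarith [g.norm_b_lt, h.norm_b_lt, norm_nonneg g.b, norm_nonneg h.b]

instance : Mul CoverGroup where
  mul g h :=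
    { a := g.a * h.a + g.b * conj h.b
      b := g.a * h.b + g.b * conj h.a
      A := g.A + h.A + Complex.log (1 + g.b * conj h.b / (g.a * h.a))
      det_eq_one := by
        have h1 := g.det_eq_one
        have h2 := h.det_eq_one
        simp only [map_add, map_mul, Complex.conj_conj]
        linear_combination (h.a * conj h.a - h.b * conj h.b) * h1 + h2
      exp_A := by
        have h0 := ne_zero_of_re_pos (re_one_add_pos (g.norm_cross_lt h))
        rw [Complex.exp_add, Complex.exp_add, Complex.exp_log h0, g.exp_A, h.exp_A]
        field_simp [g.a_ne_zero, h.a_ne_zero] }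

instance : One CoverGroup where
  one := ⟨1, 0, 0, by simp, by simp⟩

instance : Inv CoverGroup where
  inv g := ⟨conj g.a, -g.b, conj g.A, by
    have := g.det_eq_one
    simp only [map_neg, Complex.conj_conj]
    linear_combination this, by
    rw [← g.exp_A, Complex.exp_conj]⟩

@[simp] lemma mul_a : (g * h).a = g.a * h.a + g.b * conj h.b := rfl
@[simp] lemma mul_b : (g * h).b = g.a * h.b + g.b * conj h.a := rfl
@[simp] lemma mul_A :
    (g * h).A = g.A + h.A + Complex.log (1 + g.b * conj h.b / (g.a * h.a)) := rfl
@[simp] lemma one_a : (1 : CoverGroup).a = 1 := rfl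
@[simp] lemma one_b : (1 : CoverGroup).b = 0 := rfl
@[simp] lemma one_A : (1 : CoverGroup).A = 0 := rfl
@[simp] lemma inv_a : (g⁻¹).a = conj g.a := rfl
@[simp] lemma inv_b : (g⁻¹).b = -g.b := rfl
@[simp] lemma inv_A : (g⁻¹).A = conj g.A := rfl

lemma mul_assoc_aux : g * h * k = g * (h * k) := by
  have ea : (g * h * k).a = (g * (h * k)).a := by simp; ring
  refine CoverGroup.ext ea (by simp; ring) ?_
  refine eq_of_exp_eq ?_ ?_
  · rw [exp_A, exp_A, ea]
  · have i1 := abs_lt.1 (abs_log_im_lt (re_one_add_pos (g.norm_cross_lt h)))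
    have i2 := abs_lt.1 (abs_log_im_lt (re_one_add_pos ((g * h).norm_cross_lt k)))
    have i3 := abs_lt.1 (abs_log_im_lt (re_one_add_pos (h.norm_cross_lt k)))
    have i4 := abs_lt.1 (abs_log_im_lt (re_one_add_pos (g.norm_cross_lt (h * k))))
    rw [mul_A (g * h) k, mul_A g (h * k), mul_A g h, mul_A h k]
    simp only [Complex.add_im]
    rw [abs_lt]
    constructor <;> linarith [i1.1, i1.2, i2.1, i2.2, i3.1, i3.2, i4.1, i4.2]

lemma inv_mul_aux : g⁻¹ * g = 1 := by
  have ea : (g⁻¹ * g).a = (1 : CoverGroup).a := by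
    simp; linear_combination g.det_eq_one
  refine CoverGroup.ext ea (by simp; ring) ?_
  refine eq_of_exp_eq ?_ ?_
  · rw [exp_A, exp_A, ea]
  · have i1 := abs_lt.1 (abs_log_im_lt (re_one_add_pos ((g⁻¹).norm_cross_lt g)))
    rw [mul_A, one_A, inv_A]
    simp only [Complex.add_im, Complex.conj_im, Complex.zero_im]
    rw [abs_lt]
    constructor <;> linarith [i1.1, i1.2, Real.pi_pos]

instance : Group CoverGroup where
  mul_assoc := mul_assoc_aux
  one_mul g := by ext <;> simp
  mul_one g := by ext <;> simp
  inv_mul_cancel := inv_mul_aux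

/-- The inverse of the linear fractional transformation of the disk defined by `g`. -/
def moebiusInv (z : ℂ) : ℂ := (conj g.a * z - g.b) / (-conj g.b * z + g.a)

/-- The factor `(-conj b * z + a) ^ (-2m)`, with the branch on the disk selected by `A`. -/
def factor (m : ℝ) (z : ℂ) : ℂ :=
  Complex.exp (-2 * m * g.A) * (1 - conj g.b / g.a * z) ^ (-2 * m : ℂ)

/-- The action of `g` on (possibly meromorphic) differentials of degree `m`:
`f(z)(dz)^m` goes to `f((conj a * z - b)/(-conj b * z + a)) * (-conj b * z + a)^(-2m) (dz)^m`. -/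
def act (m : ℝ) (f : ℂ → ℂ) : ℂ → ℂ := fun z => f (g.moebiusInv z) * g.factor m z

/-- The logarithm on the disk of `-conj b * z + a`. -/
def logDenom (z : ℂ) : ℂ := g.A + Complex.log (1 - conj g.b / g.a * z)

variable {z : ℂ}

lemma re_factor_pos (hz : ‖z‖ < 1) : 0 < (1 - conj g.b / g.a * z).re :=
  re_one_sub_pos (g.norm_div_mul_lt hz.le)

lemma exp_logDenom (hz : ‖z‖ < 1) : Complex.exp (g.logDenom z) = -conj g.b * z + g.a := by
  rw [logDenom, Complex.exp_add, Complex.exp_log (ne_zero_of_re_pos (g.re_factor_pos hz)), g.exp_A]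
  field_simp [g.a_ne_zero]
  ring

lemma denom_ne_zero (hz : ‖z‖ < 1) : -conj g.b * z + g.a ≠ 0 := by
  rw [← g.exp_logDenom hz]; exact Complex.exp_ne_zero _

lemma factor_eq (m : ℝ) (hz : ‖z‖ < 1) :
    g.factor m z = Complex.exp (-2 * m * g.logDenom z) := by
  rw [factor, Complex.cpow_def_of_ne_zero (ne_zero_of_re_pos (g.re_factor_pos hz)),
    ← Complex.exp_add, logDenom]
  congr 1; ring

lemma norm_moebiusInv_lt (hz : ‖z‖ < 1) : ‖g.moebiusInv z‖ < 1 := by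
  have hd := norm_pos_iff.2 (g.denom_ne_zero hz)
  rw [moebiusInv, norm_div, div_lt_one hd]
  have key : ‖-conj g.b * z + g.a‖ ^ 2 - ‖conj g.a * z - g.b‖ ^ 2 = 1 - ‖z‖ ^ 2 := by
    have h := g.det_eq_one
    have : (((‖-conj g.b * z + g.a‖ ^ 2 - ‖conj g.a * z - g.b‖ ^ 2 : ℝ)) : ℂ)
        = ((1 - ‖z‖ ^ 2 : ℝ) : ℂ) := by
      push_cast
      rw [← Complex.mul_conj', ← Complex.mul_conj', ← Complex.mul_conj']
      simp only [map_add, map_sub, map_mul, map_neg, Complex.conj_conj]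
      linear_combination (1 - z * conj z) * h
    exact_mod_cast this
  nlinarith [norm_nonneg (conj g.a * z - g.b), norm_nonneg z]

lemma moebiusInv_mul (hz : ‖z‖ < 1) :
    (g * h).moebiusInv z = h.moebiusInv (g.moebiusInv z) := by
  have h1 := g.denom_ne_zero hz
  have h2 := h.denom_ne_zero (g.norm_moebiusInv_lt hz)
  have h3 := (g * h).denom_ne_zero hz
  have e1 : -conj h.b * g.moebiusInv z + h.a
      = (-conj (g * h).b * z + (g * h).a) / (-conj g.b * z + g.a) := by
    rw [moebiusInv, eq_div_iff h1, add_mul, mul_assoc, div_mul_cancel₀ _ h1]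
    simp; ring
  have e2 : conj h.a * g.moebiusInv z - h.b
      = (conj (g * h).a * z - (g * h).b) / (-conj g.b * z + g.a) := by
    rw [moebiusInv, eq_div_iff h1, sub_mul, mul_assoc, div_mul_cancel₀ _ h1]
    simp; ring
  conv_rhs => rw [moebiusInv, e1, e2, div_div_div_cancel_right₀ h1]
  rw [moebiusInv]

lemma logDenom_mul (hz : ‖z‖ < 1) :
    (g * h).logDenom z = h.logDenom (g.moebiusInv z) + g.logDenom z := by
  have hw := g.norm_moebiusInv_lt hz
  refine eq_of_exp_eq ?_ ?_
  · rw [Complex.exp_add, exp_logDenom _ hz, exp_logDenom _ hw, exp_logDenom _ hz, moebiusInv,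
      add_mul, mul_assoc, div_mul_cancel₀ _ (g.denom_ne_zero hz)]
    simp; ring
  · have i1 := abs_lt.1 (abs_log_im_lt (re_one_add_pos (g.norm_cross_lt h)))
    have i2 := abs_lt.1 (abs_log_im_lt ((g * h).re_factor_pos hz))
    have i3 := abs_lt.1 (abs_log_im_lt (g.re_factor_pos hz))
    have i4 := abs_lt.1 (abs_log_im_lt (h.re_factor_pos hw))
    rw [logDenom, logDenom, logDenom, mul_A g h]
    simp only [Complex.add_im]
    rw [abs_lt]
    constructor <;> linarith [i1.1, i1.2, i2.1, i2.2, i3.1, i3.2, i4.1, i4.2]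

lemma act_mul (m : ℝ) (f : ℂ → ℂ) (hz : ‖z‖ < 1) :
    (g * h).act m f z = g.act m (h.act m f) z := by
  have hw := g.norm_moebiusInv_lt hz
  simp only [act]
  rw [factor_eq _ _ hz, factor_eq _ _ hw, factor_eq _ _ hz, moebiusInv_mul _ _ hz,
    logDenom_mul _ _ hz, mul_assoc (f _), ← Complex.exp_add]
  congr 2; ring

lemma act_one (m : ℝ) (f : ℂ → ℂ) : (1 : CoverGroup).act m f z = f z := by
  simp [act, factor, moebiusInv]

lemma differentiableOn_act (m : ℝ) {f : ℂ → ℂ}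
    (hf : DifferentiableOn ℂ f (Metric.ball 0 1)) :
    DifferentiableOn ℂ (g.act m f) (Metric.ball 0 1) := by
  have hmoeb : DifferentiableOn ℂ g.moebiusInv (Metric.ball 0 1) := by
    refine DifferentiableOn.div (by fun_prop) (by fun_prop) fun z hz => ?_
    exact g.denom_ne_zero (mem_ball_zero_iff.1 hz)
  refine DifferentiableOn.mul ?_ ?_
  · refine hf.comp hmoeb fun z hz => ?_
    exact mem_ball_zero_iff.2 (g.norm_moebiusInv_lt (mem_ball_zero_iff.1 hz))
  · refine DifferentiableOn.const_mul ?_ _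
    refine DifferentiableOn.cpow (by fun_prop) (by fun_prop) fun z hz => ?_
    exact Or.inl (g.re_factor_pos (mem_ball_zero_iff.1 hz))

end CoverGroup

/-! ### Holomorphic differentials on the unit disk -/

/-- Extension by zero of a function on the unit disk. -/
def extendZero (f : 𝔻 → ℂ) (z : ℂ) : ℂ := if hz : ‖z‖ < 1 then f (.mk z hz) else 0

lemma extendZero_of_lt (f : 𝔻 → ℂ) {z : ℂ} (hz : ‖z‖ < 1) : extendZero f z = f (.mk z hz) :=
  dif_pos hz

@[simp] lemma extendZero_coe (f : 𝔻 → ℂ) (z : 𝔻) : extendZero f z = f z := by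
  rw [extendZero_of_lt f z.norm_lt_one, Complex.UnitDisc.mk_coe]

/-- Functions on the disk that are holomorphic. -/
def IsHolomorphic (f : 𝔻 → ℂ) : Prop := DifferentiableOn ℂ (extendZero f) (Metric.ball 0 1)

lemma isHolomorphic_of_eq {f : 𝔻 → ℂ} {F : ℂ → ℂ}
    (hF : DifferentiableOn ℂ F (Metric.ball 0 1)) (h : ∀ z : 𝔻, f z = F z) :
    IsHolomorphic f := by
  refine hF.congr fun z hz => ?_
  rw [extendZero_of_lt f (mem_ball_zero_iff.1 hz), h, Complex.UnitDisc.coe_mk]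

lemma IsHolomorphic.continuous {f : 𝔻 → ℂ} (hf : IsHolomorphic f) : Continuous f := by
  have h : Continuous fun z : 𝔻 => extendZero f (z : ℂ) :=
    hf.continuousOn.comp_continuous Complex.UnitDisc.continuous_coe
      fun z => mem_ball_zero_iff.2 z.norm_lt_one
  simpa using h

/-- The holomorphic functions, as a subspace of the continuous functions on the disk. -/
def holomorphicSubmodule : Submodule ℂ C(𝔻, ℂ) where
  carrier := {f | IsHolomorphic f}
  add_mem' {f g} hf hg := isHolomorphic_of_eq (DifferentiableOn.add hf hg) fun z => by simp
  zero_mem' := isHolomorphic_of_eq (F := fun _ => 0) (by fun_prop) fun z => by simp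
  smul_mem' c f hf := isHolomorphic_of_eq (DifferentiableOn.const_smul hf c) fun z => by simp

/-- The space `H^m(Δ)` of holomorphic differentials `f(z)(dz)^m` on the disk, with the topology of
uniform convergence on compact sets and its Borel structure. -/
def HolDifferential (_m : ℝ) : Type := holomorphicSubmodule

namespace HolDifferential

variable {m n : ℝ}

instance : AddCommGroup (HolDifferential m) := inferInstanceAs (AddCommGroup holomorphicSubmodule)
instance : Module ℂ (HolDifferential m) := inferInstanceAs (Module ℂ holomorphicSubmodule)
instance : TopologicalSpace (HolDifferential m) :=
  inferInstanceAs (TopologicalSpace holomorphicSubmodule)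
instance : MeasurableSpace (HolDifferential m) := borel _
instance : BorelSpace (HolDifferential m) := ⟨rfl⟩

/-- The coefficient function `f` of the differential `f(z)(dz)^m`. -/
instance : CoeFun (HolDifferential m) (fun _ => 𝔻 → ℂ) := ⟨fun θ => θ.1⟩

/-- The differential `f(z)(dz)^m` with a given holomorphic coefficient function. -/
def mk (f : 𝔻 → ℂ) (hf : IsHolomorphic f) : HolDifferential m := ⟨⟨f, hf.continuous⟩, hf⟩

@[simp] lemma mk_apply (f : 𝔻 → ℂ) (hf : IsHolomorphic f) (z : 𝔻) :
    (mk f hf : HolDifferential m) z = f z := rfl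

lemma holo (θ : HolDifferential m) : IsHolomorphic θ := θ.2

@[ext] lemma ext {θ θ' : HolDifferential m} (h : ∀ z, θ z = θ' z) : θ = θ' :=
  Subtype.ext (ContinuousMap.ext h)

instance : SMul CoverGroup (HolDifferential m) where
  smul g θ := mk (fun z => g.act m (extendZero θ) z)
    (isHolomorphic_of_eq (g.differentiableOn_act m θ.holo) fun _ => rfl)

lemma smul_apply (g : CoverGroup) (θ : HolDifferential m) (z : 𝔻) :
    (g • θ) z = g.act m (extendZero θ) z := rfl

instance : MulAction CoverGroup (HolDifferential m) where
  one_smul θ := by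
    ext z
    rw [smul_apply, CoverGroup.act_one, extendZero_coe]
  mul_smul g h θ := by
    ext z
    rw [smul_apply, smul_apply, CoverGroup.act_mul _ _ _ _ z.norm_lt_one]
    simp only [CoverGroup.act]
    rw [extendZero_of_lt (h • θ : HolDifferential m) (g.norm_moebiusInv_lt z.norm_lt_one), smul_apply]
    rfl

/-- The multiplication map `H^m × H^n → H^(m+n)`. -/
def mul (θ : HolDifferential m) (θ' : HolDifferential n) : HolDifferential (m + n) :=
  mk (fun z => θ z * θ' z)
    (isHolomorphic_of_eq (DifferentiableOn.mul θ.holo θ'.holo) fun z => by simp)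

open Classical in
/-- The quotient map `(θ, θ') ↦ θ / θ'` from `H^m × H^n` to `H^(m-n)`, for `θ'` without zeros in
the disk (and zero otherwise). -/
def quot (θ : HolDifferential m) (θ' : HolDifferential n) : HolDifferential (m - n) :=
  if h : ∀ z, θ' z ≠ 0 then
    mk (fun z => θ z / θ' z)
      (isHolomorphic_of_eq (F := fun z => extendZero θ z / extendZero θ' z)
        (DifferentiableOn.div θ.holo θ'.holo fun z hz => by
          rw [extendZero_of_lt _ (mem_ball_zero_iff.1 hz)]; exact h _) fun z => by simp)
  else 0

end HolDifferential

/-- `ν` is an ergodic invariant probability measure on `H^m(Δ)`. -/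
structure IsErgodicInvariant {m : ℝ} (ν : Measure (HolDifferential m)) : Prop where
  isProbabilityMeasure : IsProbabilityMeasure ν
  ergodicSMul : ErgodicSMul CoverGroup (HolDifferential m) ν

/-- The multiplicative image of two measures. -/
def mulImage {m n : ℝ} (ν : Measure (HolDifferential m)) (μ : Measure (HolDifferential n)) :
    Measure (HolDifferential (m + n)) :=
  (ν.prod μ).map fun p => p.1.mul p.2

/-- The quotient image of two measures, on `H^(m-n)`; meaningful if `μ` is supported on
differentials without zeros. -/
def quotImage {m n : ℝ} (ν : Measure (HolDifferential m)) (μ : Measure (HolDifferential n)) :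
    Measure (HolDifferential (m - n)) :=
  (ν.prod μ).map fun p => p.1.quot p.2

/-! ### Formal completions -/

/-- The formal completion of `H^k(Δ)`: differentials `f(z)(dz)^k` with `f` a formal power series. -/
def FormalDifferential (_k : ℝ) : Type := PowerSeries ℂ

namespace FormalDifferential

variable {k m n : ℝ}

/-- The formal power series `f` of the formal differential `f(z)(dz)^k`. -/
def toPowerSeries (F : FormalDifferential k) : PowerSeries ℂ := F

/-- The `i`-th coefficient. -/
def coeff (i : ℕ) (F : FormalDifferential k) : ℂ := PowerSeries.coeff i F.toPowerSeries

/-- The product Borel structure on sequences of coefficients. -/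
instance : MeasurableSpace (FormalDifferential k) :=
  ⨆ i : ℕ, MeasurableSpace.comap (coeff i) inferInstance

/-- The Taylor series at `0`. -/
def taylor (k : ℝ) (f : ℂ → ℂ) : FormalDifferential k :=
  PowerSeries.mk fun i => iteratedDeriv i f 0 / (i.factorial : ℂ)

/-- The quotient `F / G` of formal power series, for `G` with nonzero constant term. -/
def quot (F : FormalDifferential m) (G : FormalDifferential n) : FormalDifferential (m - n) :=
  (F.toPowerSeries * G.toPowerSeries⁻¹ : PowerSeries ℂ)

/-- `IsTranslate g F F'` says that `g • F` is defined and equal to `F'`: there is a meromorphic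
differential of degree `k` on the disk, regular at `0` with Taylor series `F`, whose image under `g`
is regular at `0` with Taylor series `F'`. -/
def IsTranslate (g : CoverGroup) (F F' : FormalDifferential k) : Prop :=
  ∃ φ : ℂ → ℂ, MeromorphicOn φ (Metric.ball 0 1) ∧
    AnalyticAt ℂ φ 0 ∧ taylor k φ = F ∧
    AnalyticAt ℂ (g.act k φ) 0 ∧ taylor k (g.act k φ) = F'

end FormalDifferential

/-- `ρ` is an ergodic invariant probability measure on the formal completion of `H^k(Δ)`: for each
`g` the translate by `g` is defined almost everywhere and preserves `ρ`, and every Borel set that is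
almost everywhere invariant under each `g` is null or conull. -/
structure IsFormalErgodicInvariant {k : ℝ} (ρ : Measure (FormalDifferential k)) : Prop where
  isProbabilityMeasure : IsProbabilityMeasure ρ
  invariant : ∀ g : CoverGroup, ∃ T : FormalDifferential k → FormalDifferential k,
    MeasurePreserving T ρ ρ ∧ ∀ᵐ F ∂ρ, FormalDifferential.IsTranslate g F (T F)
  ergodic : ∀ E : Set (FormalDifferential k), MeasurableSet E →
    (∀ g : CoverGroup, ∀ᵐ F ∂ρ, ∀ F', FormalDifferential.IsTranslate g F F' → (F' ∈ E ↔ F ∈ E)) →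
    ρ E = 0 ∨ ρ Eᶜ = 0

/-- The quotient image of two measures on the formal completion of `H^(m-n)`; meaningful if `μ` is
supported on differentials that do not vanish at `0`. -/
def formalQuotImage {m n : ℝ} (ν : Measure (HolDifferential m)) (μ : Measure (HolDifferential n)) :
    Measure (FormalDifferential (m - n)) :=
  (ν.prod μ).map fun p =>
    (FormalDifferential.taylor m (extendZero p.1)).quot
      (FormalDifferential.taylor n (extendZero p.2))

end ConformalMeasures

end

open ConformalMeasures

/-! Addition, multiplication and division of differentials are measurable and commute with the
group, and an equivariant image of an ergodic action is ergodic. So everything reduces to the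
ergodicity of `ν.prod μ` under the diagonal action (`ergodicSMul_prod`). Products of ergodic actions
are not ergodic in general; here the structure of the covering group forces it.

Let `E` be an invariant subset of the product and put Φ(B, A) = (ν × μ)(E ∩ B × A), which is
invariant under the diagonal action on (B, A). The operator with kernel 1_E is compact, so for any
sequence of sets Aₙ some subsequence makes Φ(B, Aₙ) vary by at most ε, uniformly in B
(`rectPrecompact_prod`). Hence powers of a hyperbolic element a are recurrent: Φ(B, a⁻ᵏA) is close
to Φ(B, A) for arbitrarily large k. Since aᵏ contracts a parabolic u to the identity under
conjugation, and the action is continuous in measure, Φ(B, u⁻¹A) = Φ(B, A): this is the Mautner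
phenomenon (`measureReal_inter_preimage_parabolic`). The elements acting trivially on the second
argument form a normal subgroup, which is then the whole group (`eq_top_of_parabolic_mem`). So `E`
is invariant under each factor separately, and ergodicity of ν and μ gives Φ(B, A) = Φ(X, Y) ν(B)
μ(A), that is, `E` is independent of itself.

On the formal completion the group acts only partially. There, invariance and ergodicity are checked
on pairs (f, g), where the action is genuine. What is needed is that translates of formal series are
unique (identity theorem), and that almost-everywhere statements and measurable maps descend along
the quotient map (descriptive set theory). -/

noncomputable section

namespace ConformalMeasures

open Filter Topology
open scoped symmDiff

/-! ### Generation of the covering group by conjugates of parabolic elements -/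

namespace CoverGroup

/-- The matrix determines `A` up to multiples of 2πi, so a crude bound selects the sheet. Identities
in the cover then follow from matrix identities, each logarithm involved contributing less than π/2.
-/
lemma ext_of_abs_im_lt {g h : CoverGroup} (ha : g.a = h.a) (hb : g.b = h.b)
    (hA : |g.A.im - h.A.im| < 2 * Real.pi) : g = h :=
  CoverGroup.ext ha hb (eq_of_exp_eq (by rw [exp_A, exp_A, ha]) hA)

lemma abs_im_mul_sub_lt (g h : CoverGroup) :
    |(g * h).A.im - (g.A.im + h.A.im)| < Real.pi / 2 := by
  have := abs_log_im_lt (re_one_add_pos (g.norm_cross_lt h))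
  simpa only [mul_A, Complex.add_im, add_sub_cancel_left] using this

/-- The parabolic elements with entries `1 + t i` and `t e ^ (i φ)`. -/
def parabolic (t φ : ℝ) : CoverGroup where
  a := 1 + t * Complex.I
  b := t * Complex.exp (φ * Complex.I)
  A := Complex.log (1 + t * Complex.I)
  det_eq_one := by
    have h : Complex.exp (φ * Complex.I) * conj (Complex.exp (φ * Complex.I)) = 1 := by
      rw [← Complex.exp_conj, ← Complex.exp_add]; simp
    simp only [map_add, map_mul, map_one, Complex.conj_ofReal, Complex.conj_I]
    linear_combination (-(t : ℂ) ^ 2) * h - (t : ℂ) ^ 2 * Complex.I_sq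
  exp_A := Complex.exp_log (ne_zero_of_re_pos (by simp))

/-- The elements with real positive first entry `cosh s` and second entry `i sinh s`. -/
def hyperbolic (s : ℝ) : CoverGroup where
  a := Real.cosh s
  b := Complex.I * Real.sinh s
  A := Real.log (Real.cosh s)
  det_eq_one := by
    have h : ((Real.cosh s ^ 2 - Real.sinh s ^ 2 : ℝ) : ℂ) = 1 := by
      rw [Real.cosh_sq_sub_sinh_sq]; simp
    push_cast at h
    simp only [map_mul, Complex.conj_ofReal, Complex.conj_I]
    push_cast
    linear_combination h + Complex.sinh s ^ 2 * Complex.I_sq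
  exp_A := by rw [← Complex.ofReal_exp, Real.exp_log (Real.cosh_pos s)]

/-- The rotations. -/
def rotation (φ : ℝ) : CoverGroup where
  a := Complex.exp (φ * Complex.I)
  b := 0
  A := φ * Complex.I
  det_eq_one := by rw [← Complex.exp_conj, ← Complex.exp_add]; simp
  exp_A := rfl

lemma abs_parabolic_A_im_lt (t φ : ℝ) : |(parabolic t φ).A.im| < Real.pi / 2 :=
  abs_log_im_lt (by simp)

lemma hyperbolic_A_im (s : ℝ) : (hyperbolic s).A.im = 0 := Complex.ofReal_im _

/-- Conjugation by the hyperbolic element rescales the parabolic parameter, and for `s < 0`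
contracts it to 0. This is what drives the Mautner argument. -/
lemma hyperbolic_mul_parabolic (s t : ℝ) :
    hyperbolic s * parabolic t 0 = parabolic (Real.exp (2 * s) * t) 0 * hyperbolic s := by
  have hE : (Real.exp (2 * s) : ℂ) = (Real.cosh s + Real.sinh s) ^ 2 := by
    rw [← Complex.ofReal_add, Real.cosh_add_sinh, ← Complex.ofReal_pow, ← Real.exp_nat_mul]
    norm_num
  have hD : (Real.cosh s : ℂ) ^ 2 - Real.sinh s ^ 2 = 1 := by
    exact_mod_cast congrArg Complex.ofReal (Real.cosh_sq_sub_sinh_sq s)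
  have hI := Complex.I_sq
  refine ext_of_abs_im_lt ?_ ?_ ?_
  · simp only [mul_a, hyperbolic, parabolic, Complex.ofReal_mul, map_mul, map_one,
      Complex.conj_ofReal, Complex.conj_I, Complex.ofReal_zero, zero_mul, Complex.exp_zero, hE]
    linear_combination (-(t : ℂ) * Complex.I * (Real.cosh s + Real.sinh s)) * hD
  · simp only [mul_b, hyperbolic, parabolic, Complex.ofReal_mul, map_mul, map_add, map_one,
      Complex.conj_ofReal,
      Complex.conj_I, Complex.ofReal_zero, zero_mul, Complex.exp_zero, hE]
    linear_combination (-(t : ℂ) * (Real.cosh s + Real.sinh s)) * hD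
      + (-(t : ℂ) * Real.sinh s * (1 + (Real.cosh s + Real.sinh s) ^ 2)) * hI
  -- Four bounds by π/2 add up to the required 2π.
  · have h1 := abs_lt.1 (abs_im_mul_sub_lt (hyperbolic s) (parabolic t 0))
    have h2 := abs_lt.1 (abs_im_mul_sub_lt (parabolic (Real.exp (2 * s) * t) 0) (hyperbolic s))
    have h3 := abs_lt.1 (abs_parabolic_A_im_lt t 0)
    have h4 := abs_lt.1 (abs_parabolic_A_im_lt (Real.exp (2 * s) * t) 0)
    rw [hyperbolic_A_im] at h1 h2
    rw [abs_lt]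
    constructor <;> linarith [h1.1, h1.2, h2.1, h2.2, h3.1, h3.2, h4.1, h4.2]

lemma hyperbolic_pow_mul_parabolic (s t : ℝ) (k : ℕ) :
    hyperbolic s ^ k * parabolic t 0 = parabolic (Real.exp (2 * s) ^ k * t) 0 * hyperbolic s ^ k := by
  induction k with
  | zero => simp
  | succ k ih =>
    rw [pow_succ', mul_assoc, ih, ← mul_assoc, hyperbolic_mul_parabolic, mul_assoc, ← pow_succ',
      pow_succ' (Real.exp _), mul_assoc]

lemma rotation_mul (φ : ℝ) (g : CoverGroup) :
    rotation φ * g = ⟨Complex.exp (φ * Complex.I) * g.a, Complex.exp (φ * Complex.I) * g.b,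
      φ * Complex.I + g.A, by
        have := (rotation φ * g).det_eq_one
        simpa [rotation] using this, by rw [Complex.exp_add, g.exp_A]⟩ := by
  ext <;> simp [rotation]

lemma mul_rotation (φ : ℝ) (g : CoverGroup) :
    (g * rotation φ).a = g.a * Complex.exp (φ * Complex.I) ∧
    (g * rotation φ).b = g.b * Complex.exp (-φ * Complex.I) ∧
    (g * rotation φ).A = g.A + φ * Complex.I := by
  simp [rotation, ← Complex.exp_conj]

lemma rotation_add (φ ψ : ℝ) : rotation (φ + ψ) = rotation φ * rotation ψ := by
  rw [rotation_mul]
  ext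
  · simp [rotation, add_mul, Complex.exp_add]
  · simp [rotation]
  · simp [rotation, add_mul]

lemma rotation_zero : rotation 0 = 1 := by ext <;> simp [rotation]

lemma rotation_inv (φ : ℝ) : (rotation φ)⁻¹ = rotation (-φ) :=
  inv_eq_of_mul_eq_one_right (by rw [← rotation_add, add_neg_cancel, rotation_zero])

lemma rotation_conj (φ : ℝ) (g : CoverGroup) :
    (rotation φ * g * (rotation φ)⁻¹).a = g.a ∧
    (rotation φ * g * (rotation φ)⁻¹).b = Complex.exp (2 * φ * Complex.I) * g.b ∧
    (rotation φ * g * (rotation φ)⁻¹).A = g.A := by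
  obtain ⟨h1, h2, h3⟩ := mul_rotation (-φ) (rotation φ * g)
  rw [rotation_inv, h1, h2, h3, rotation_mul]
  refine ⟨?_, ?_, ?_⟩
  · rw [mul_right_comm, ← Complex.exp_add]; simp
  · rw [mul_right_comm, ← Complex.exp_add]; congr 2; push_cast; ring
  · push_cast; ring

lemma rotation_conj_parabolic (t φ : ℝ) :
    rotation (φ / 2) * parabolic t 0 * (rotation (φ / 2))⁻¹ = parabolic t φ := by
  obtain ⟨h1, h2, h3⟩ := rotation_conj (φ / 2) (parabolic t 0)
  refine CoverGroup.ext (h1.trans rfl) (h2.trans ?_) (h3.trans rfl)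
  simp only [parabolic]
  push_cast
  rw [zero_mul, Complex.exp_zero, mul_one, mul_comm, mul_div_cancel₀ _ two_ne_zero]

/-- Here `a` is a positive real number, recovered from |a|² = 1 + |b|². -/
lemma ext_of_im_eq_zero {g h : CoverGroup} (hg : g.A.im = 0) (hh : h.A.im = 0) (hb : g.b = h.b) :
    g = h := by
  have key : ∀ k : CoverGroup, k.A.im = 0 → k.a = Real.exp k.A.re := fun k hk => by
    rw [← k.exp_A, Complex.ofReal_exp]
    congr 1
    exact Complex.ext (by simp) (by simp [hk])
  have ha : ‖g.a‖ = ‖h.a‖ := by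
    have h1 := g.norm_sq_sub
    have h2 := h.norm_sq_sub
    rw [hb] at h1
    exact (sq_eq_sq₀ (norm_nonneg _) (norm_nonneg _)).1 (by linarith)
  rw [key g hg, key h hh, Complex.norm_real, Complex.norm_real, Real.norm_of_nonneg
    (Real.exp_pos _).le, Real.norm_of_nonneg (Real.exp_pos _).le] at ha
  refine ext_of_abs_im_lt ?_ hb ?_
  · rw [key g hg, key h hh, ha]
  · simp [hg, hh, Real.pi_pos]

lemma parabolic_mul_parabolic (t φ : ℝ) :
    (parabolic t φ * parabolic (-t) (φ + Real.pi)).A.im = 0 ∧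
    (parabolic t φ * parabolic (-t) (φ + Real.pi)).b =
      2 * t * (1 + t * Complex.I) * Complex.exp (φ * Complex.I) := by
  have he : Complex.exp ((φ + Real.pi : ℝ) * Complex.I) = -Complex.exp (φ * Complex.I) := by
    push_cast
    rw [add_mul, Complex.exp_add, Complex.exp_pi_mul_I, mul_neg_one]
  have h : Complex.exp (φ * Complex.I) * conj (Complex.exp (φ * Complex.I)) = 1 := by
    rw [← Complex.exp_conj, ← Complex.exp_add]; simp
  have ha : (parabolic t φ * parabolic (-t) (φ + Real.pi)).a = (1 + 2 * t ^ 2 : ℝ) := by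
    simp only [mul_a, parabolic, he, map_mul, map_neg, Complex.ofReal_neg, Complex.conj_ofReal]
    push_cast
    linear_combination (t : ℂ) ^ 2 * h - (t : ℂ) ^ 2 * Complex.I_sq
  refine ⟨?_, ?_⟩
  · have hlog : (parabolic t φ * parabolic (-t) (φ + Real.pi)).A = Real.log (1 + 2 * t ^ 2) := by
      refine eq_of_exp_eq ?_ ?_
      · rw [exp_A, ha, ← Complex.ofReal_exp, Real.exp_log (by positivity)]
      · have h1 := abs_lt.1 (abs_im_mul_sub_lt (parabolic t φ) (parabolic (-t) (φ + Real.pi)))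
        have h3 := abs_lt.1 (abs_parabolic_A_im_lt t φ)
        have h4 := abs_lt.1 (abs_parabolic_A_im_lt (-t) (φ + Real.pi))
        rw [Complex.ofReal_im, abs_lt]
        constructor <;> linarith [h1.1, h1.2, h3.1, h3.2, h4.1, h4.2]
    rw [hlog, Complex.ofReal_im]
  · simp only [mul_b, parabolic, he, map_mul, map_add, map_one, Complex.ofReal_neg, map_neg,
      Complex.conj_ofReal, Complex.conj_I]
    ring

lemma exists_parabolic_mul_parabolic (g : CoverGroup) (hg : g.A.im = 0) :
    ∃ t φ : ℝ, g = parabolic t φ * parabolic (-t) (φ + Real.pi) := by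
  -- The modulus of the off-diagonal entry must satisfy 2t|1 + it| = |b|. With t = sinh x the left
  -- side is 2 sinh x cosh x = sinh 2x. The angle then only has to compensate for the argument of 1
  -- + it.
  set t : ℝ := Real.sinh (Real.arsinh ‖g.b‖ / 2) with ht
  set w : ℂ := 1 + t * Complex.I with hw
  refine ⟨t, Complex.arg g.b - Complex.arg w, ?_⟩
  obtain ⟨h1, h2⟩ := parabolic_mul_parabolic t (Complex.arg g.b - Complex.arg w)
  refine ext_of_im_eq_zero hg h1 ?_
  rw [h2, ← hw]
  have hnw : ‖w‖ = Real.cosh (Real.arsinh ‖g.b‖ / 2) := by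
    have : ‖w‖ ^ 2 = Real.cosh (Real.arsinh ‖g.b‖ / 2) ^ 2 := by
      rw [← Complex.normSq_eq_norm_sq, Real.cosh_sq, ← ht, hw]
      simp [Complex.normSq_apply]
      ring
    exact (sq_eq_sq₀ (norm_nonneg _) (Real.cosh_pos _).le).1 this
  have hnb : 2 * t * ‖w‖ = ‖g.b‖ := by
    rw [hnw, ht, ← Real.sinh_two_mul, mul_div_cancel₀ _ two_ne_zero, Real.sinh_arsinh]
  have hnb' : (2 * t * ‖w‖ : ℂ) = ‖g.b‖ := by exact_mod_cast hnb
  have he : Complex.exp (Complex.arg w * Complex.I) *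
      Complex.exp ((Complex.arg g.b - Complex.arg w : ℝ) * Complex.I) =
        Complex.exp (Complex.arg g.b * Complex.I) := by
    rw [← Complex.exp_add]; congr 1; push_cast; ring
  linear_combination -Complex.norm_mul_exp_arg_mul_I g.b
    + 2 * t * Complex.exp ((Complex.arg g.b - Complex.arg w : ℝ) * Complex.I) *
      Complex.norm_mul_exp_arg_mul_I w
    - Complex.exp (Complex.arg g.b * Complex.I) * hnb' - 2 * t * ‖w‖ * he

lemma rotation_mul_A_im (g : CoverGroup) :
    (rotation (-g.A.im) * g).A.im = 0 := by
  rw [rotation_mul]; simp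

/-- A normal subgroup containing a one-parameter family of parabolic elements is everything. -/
theorem eq_top_of_parabolic_mem (N : Subgroup CoverGroup) [N.Normal]
    (hN : ∀ t, parabolic t 0 ∈ N) : N = ⊤ := by
  have hpar (t φ : ℝ) : parabolic t φ ∈ N := by
    rw [← rotation_conj_parabolic]
    exact Subgroup.Normal.conj_mem inferInstance _ (hN t) _
  have hpos (g : CoverGroup) (hg : g.A.im = 0) : g ∈ N := by
    obtain ⟨t, φ, rfl⟩ := exists_parabolic_mul_parabolic g hg
    exact N.mul_mem (hpar _ _) (hpar _ _)
  -- The parabolic element with t = tan θ has a = 1 + i tan θ of argument θ. Rotating by -θ makes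
  -- `A` real, so both the parabolic and its rotated form lie in `N`, hence so does the rotation.
  have hrot_small (θ : ℝ) (hθ : |θ| < Real.pi / 2) : rotation θ ∈ N := by
    have h := hpos _ (rotation_mul_A_im (parabolic (Real.tan θ) 0))
    have him : (parabolic (Real.tan θ) 0).A.im = θ := by
      have hw : (1 + Real.tan θ * Complex.I : ℂ) =
          ((Real.cos θ)⁻¹ : ℝ) * (Complex.cos θ + Complex.sin θ * Complex.I) := by
        have hc : Complex.cos θ ≠ 0 := by
          rw [← Complex.ofReal_cos]
          exact_mod_cast (Real.cos_pos_of_mem_Ioo (abs_lt.1 hθ)).ne'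
        push_cast
        rw [Complex.tan_eq_sin_div_cos]
        field_simp
      have hpi := abs_lt.1 hθ
      simp only [parabolic]
      rw [Complex.log_im, hw, Complex.arg_mul_cos_add_sin_mul_I
        (inv_pos.2 (Real.cos_pos_of_mem_Ioo (abs_lt.1 hθ)))]
      constructor <;> linarith [hpi.1, hpi.2, Real.pi_pos]
    rw [him, ← rotation_inv] at h
    have := N.mul_mem (hpar (Real.tan θ) 0) (N.inv_mem h)
    simpa using this
  have hrot (θ : ℝ) : rotation θ ∈ N := by
    obtain ⟨n, hn⟩ := exists_nat_gt |θ|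
    have hn0 : (0 : ℝ) < n := (abs_nonneg θ).trans_lt hn
    have hpow : ∀ k : ℕ, rotation (θ / n) ^ k = rotation (k * (θ / n)) := fun k => by
      induction k with
      | zero => simp [rotation_zero]
      | succ k ih =>
        rw [pow_succ, ih, ← rotation_add]
        congr 1
        push_cast
        ring
    have h := N.pow_mem (hrot_small (θ / n) (by
      rw [abs_div, Nat.abs_cast, div_lt_iff₀ hn0]
      nlinarith [Real.pi_gt_three])) n
    rwa [hpow, mul_div_cancel₀ _ hn0.ne'] at h
  -- Polar decomposition: every element is a rotation times an element with `A` real.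
  refine (Subgroup.eq_top_iff' N).2 fun g => ?_
  have := N.mul_mem (N.inv_mem (hrot (-g.A.im))) (hpos _ (rotation_mul_A_im g))
  rwa [inv_mul_cancel_left] at this

end CoverGroup

/-! ### Compactness of the kernel of a measurable set -/

section Precompact

variable {X Y : Type*} [MeasurableSpace X] [MeasurableSpace Y]

lemma exists_subseq_abs_sub_le (x : ℕ → ℝ) (hx : ∀ n, x n ∈ Set.Icc (0 : ℝ) 1) {ε : ℝ}
    (hε : 0 < ε) : ∃ φ : ℕ → ℕ, StrictMono φ ∧ ∀ m n, |x (φ m) - x (φ n)| ≤ ε := by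
  obtain ⟨a, -, φ, hφ, hlim⟩ := isCompact_Icc.tendsto_subseq hx
  obtain ⟨N, hN⟩ := Metric.cauchySeq_iff.1 hlim.cauchySeq ε hε
  exact ⟨fun n => φ (n + N), fun m n h => hφ (by omega),
    fun m n => (hN (m + N) (by omega) (n + N) (by omega)).le⟩

/-- The set `E` is such that the functions `B ↦ κ (E ∩ B ×ˢ A)` form a precompact family for the
uniform distance. -/
def RectPrecompact (κ : Measure (X × Y)) (E : Set (X × Y)) : Prop :=
  ∀ ε > 0, ∀ A : ℕ → Set Y, ∃ φ : ℕ → ℕ, StrictMono φ ∧ ∀ m n (B : Set X),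
    |κ.real (E ∩ B ×ˢ A (φ m)) - κ.real (E ∩ B ×ˢ A (φ n))| ≤ ε

lemma RectPrecompact.union {κ : Measure (X × Y)} [IsFiniteMeasure κ] {E F : Set (X × Y)}
    (hE : RectPrecompact κ E) (hF : RectPrecompact κ F) (hFm : MeasurableSet F)
    (hd : Disjoint E F) : RectPrecompact κ (E ∪ F) := by
  intro ε hε A
  obtain ⟨φ, hφ, h1⟩ := hE (ε / 2) (half_pos hε) A
  obtain ⟨ψ, hψ, h2⟩ := hF (ε / 2) (half_pos hε) (A ∘ φ)
  refine ⟨φ ∘ ψ, hφ.comp hψ, fun m n B => ?_⟩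
  have key (S : Set (X × Y)) : κ.real ((E ∪ F) ∩ S) = κ.real (E ∩ S) + κ.real (F ∩ S) := by
    have := measureReal_inter_add_sdiff (μ := κ) (s := (E ∪ F) ∩ S) hFm
    rw [← this, add_comm]
    congr 2 <;> ext p
    · have : p ∈ E → p ∉ F := fun h => Set.disjoint_left.1 hd h
      simp only [Set.mem_sdiff, Set.mem_inter_iff, Set.mem_union]; tauto
    · simp only [Set.mem_inter_iff, Set.mem_union]; tauto
  rw [key, key, add_sub_add_comm]
  refine (abs_add_le _ _).trans ?_
  have e1 := h1 (ψ m) (ψ n) B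
  have e2 := h2 m n B
  simp only [Function.comp_apply] at e2 ⊢
  linarith

/-- An elementary form of the compactness of the integral operator with kernel 1_E. Rectangles give
rank one, and the property survives complements, finite disjoint unions and approximation in
measure, so it passes to all measurable sets. -/
theorem rectPrecompact_prod (ν : Measure X) (μ : Measure Y) [IsProbabilityMeasure ν]
    [IsProbabilityMeasure μ] {E : Set (X × Y)} (hE : MeasurableSet E) :
    RectPrecompact (ν.prod μ) E := by
  induction E, hE using MeasurableSpace.induction_on_inter generateFrom_prod.symm isPiSystem_prod with
  | empty => exact fun ε hε A => ⟨id, strictMono_id, fun m n B => by simpa using hε.le⟩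
  | basic t ht =>
    obtain ⟨P, -, Q, -, rfl⟩ := ht
    intro ε hε A
    -- For a rectangle the dependence on `A n` is through one number in [0, 1].
    obtain ⟨φ, hφ, h⟩ := exists_subseq_abs_sub_le (fun n => μ.real (Q ∩ A n))
      (fun n => ⟨measureReal_nonneg, measureReal_le_one⟩) hε
    refine ⟨φ, hφ, fun m n B => ?_⟩
    rw [Set.prod_inter_prod, Set.prod_inter_prod, measureReal_prod_prod, measureReal_prod_prod,
      ← mul_sub, abs_mul, abs_of_nonneg measureReal_nonneg]
    exact (mul_le_of_le_one_left (abs_nonneg _) measureReal_le_one).trans (h m n)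
  | compl t htm ih =>
    intro ε hε A
    obtain ⟨φ, hφ, h1⟩ := exists_subseq_abs_sub_le (fun n => μ.real (A n))
      (fun n => ⟨measureReal_nonneg, measureReal_le_one⟩) (half_pos hε)
    obtain ⟨ψ, hψ, h2⟩ := ih (ε / 2) (half_pos hε) (A ∘ φ)
    refine ⟨φ ∘ ψ, hφ.comp hψ, fun m n B => ?_⟩
    have key (S : Set Y) : (ν.prod μ).real (tᶜ ∩ B ×ˢ S) =
        ν.real B * μ.real S - (ν.prod μ).real (t ∩ B ×ˢ S) := by
      rw [← measureReal_prod_prod, ← measureReal_inter_add_sdiff (s := B ×ˢ S) htm, Set.inter_comm t,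
        Set.inter_comm, ← Set.sdiff_eq]
      ring
    have e1 := (mul_le_of_le_one_left (abs_nonneg _) (measureReal_le_one (μ := ν) (s := B))).trans
      (h1 (ψ m) (ψ n))
    have e2 := h2 m n B
    rw [key, key, sub_sub_sub_comm, ← mul_sub]
    refine (abs_sub _ _).trans ?_
    rw [abs_mul, abs_of_nonneg measureReal_nonneg]
    simp only [Function.comp_apply] at e2 ⊢
    linarith
  | iUnion f hd hm ih =>
    have hacc (k : ℕ) : RectPrecompact (ν.prod μ) (Set.accumulate f k) := by
      induction k with
      | zero => simpa using ih 0
      | succ k ihk =>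
        rw [Set.accumulate_succ]
        exact ihk.union (ih _) (hm _) (Set.disjoint_accumulate hd (Nat.lt_succ_self k))
    have hacm (k : ℕ) : MeasurableSet (Set.accumulate f k) := by
      rw [Set.accumulate_def]
      exact MeasurableSet.biUnion (Set.to_countable _) fun i _ => hm i
    intro ε hε A
    have hlim : Tendsto (fun k => (ν.prod μ).real (Set.accumulate f k)) atTop
        (𝓝 ((ν.prod μ).real (⋃ i, f i))) :=
      (ENNReal.tendsto_toReal (measure_ne_top _ _)).comp tendsto_measure_iUnion_accumulate
    -- Finitely many pieces suffice: the rest has mass below ε/3 whatever `B` and `A n` are.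
    obtain ⟨k, hk⟩ := (hlim.eventually (lt_mem_nhds
      (show (ν.prod μ).real (⋃ i, f i) - ε / 3 < _ by linarith))).exists
    obtain ⟨φ, hφ, h⟩ := hacc k (ε / 3) (by linarith) A
    refine ⟨φ, hφ, fun m n B => ?_⟩
    have hsub : Set.accumulate f k ⊆ ⋃ i, f i := Set.accumulate_subset_iUnion k
    have hdiff := measureReal_sdiff hsub (hacm k) (μ := ν.prod μ)
    have key (S : Set (X × Y)) : (ν.prod μ).real (Set.accumulate f k ∩ S) ≤
        (ν.prod μ).real ((⋃ i, f i) ∩ S) ∧ (ν.prod μ).real ((⋃ i, f i) ∩ S) ≤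
        (ν.prod μ).real (Set.accumulate f k ∩ S) + ε / 3 := by
      refine ⟨measureReal_mono (Set.inter_subset_inter_left _ hsub), ?_⟩
      refine (measureReal_mono (s₂ := (Set.accumulate f k ∩ S) ∪
        ((⋃ i, f i) \ Set.accumulate f k)) fun p hp => ?_).trans
        ((measureReal_union_le _ _).trans (by linarith))
      by_cases h : p ∈ Set.accumulate f k
      · exact Or.inl ⟨h, hp.2⟩
      · exact Or.inr ⟨hp.1, h⟩
    have e := abs_le.1 (h m n B)
    have e1 := key (B ×ˢ A (φ m))
    have e2 := key (B ×ˢ A (φ n))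
    rw [abs_le]
    constructor <;> linarith [e.1, e.2, e1.1, e1.2, e2.1, e2.2]

end Precompact

/-! ### Continuity of the action in the measure algebra -/

section Continuity

variable {Y : Type*} [TopologicalSpace Y] [MeasurableSpace Y] [BorelSpace Y]

/-- For open U, a point of U is eventually mapped into U, so U \ τₙ⁻¹U shrinks to a null set;
invariance of μ gives τₙ⁻¹U \ U the same mass. Other Borel sets follow by induction. -/
theorem tendsto_measureReal_preimage_symmDiff (μ : Measure Y) [IsProbabilityMeasure μ]
    {τ : ℕ → Y → Y} (hτ : ∀ n, MeasurePreserving (τ n) μ μ)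
    (hlim : ∀ y, Tendsto (fun n => τ n y) atTop (𝓝 y)) {A : Set Y} (hA : MeasurableSet A) :
    Tendsto (fun n => μ.real ((τ n ⁻¹' A) ∆ A)) atTop (𝓝 0) := by
  induction A, hA using MeasurableSet.induction_on_open with
  | isOpen U hU =>
    have hUm := hU.measurableSet
    have h1 : Tendsto (fun n => μ (U \ τ n ⁻¹' U)) atTop (𝓝 (μ ∅)) := by
      refine tendsto_measure_of_ae_tendsto_indicator_of_isFiniteMeasure atTop MeasurableSet.empty
        (fun n => hUm.diff ((hτ n).measurable hUm)) (ae_of_all _ fun y => ?_)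
      by_cases hy : y ∈ U
      · filter_upwards [(hlim y).eventually (hU.mem_nhds hy)] with n hn
        have : τ n y ∈ U := hn
        simp [this]
      · exact Eventually.of_forall fun n => by simp [hy]
    have h2 (n : ℕ) : μ.real ((τ n ⁻¹' U) ∆ U) = 2 * μ.real (U \ τ n ⁻¹' U) := by
      have hm := (hτ n).measurable hUm
      have e1 := measureReal_inter_add_sdiff (μ := μ) (s := U) hm
      have e2 := measureReal_inter_add_sdiff (μ := μ) (s := τ n ⁻¹' U) hUm
      rw [(hτ n).measureReal_preimage hUm.nullMeasurableSet, Set.inter_comm] at e2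
      rw [measureReal_symmDiff_eq (μ := μ) hm hUm]
      linarith
    simp_rw [h2]
    simpa [Function.comp_def, measureReal_def] using
      ((ENNReal.tendsto_toReal (measure_ne_top _ _)).comp h1).const_mul 2
  | compl t ht ih =>
    refine ih.congr fun n => ?_
    rw [Set.preimage_compl, compl_symmDiff_compl]
  | iUnion f hd hm ih =>
    have hacc (k : ℕ) : Tendsto (fun n =>
        μ.real ((τ n ⁻¹' Set.accumulate f k) ∆ Set.accumulate f k)) atTop (𝓝 0) := by
      induction k with
      | zero => simpa using ih 0
      | succ k ihk =>
        refine squeeze_zero (fun _ => measureReal_nonneg) (fun n => ?_)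
          (by simpa using ihk.add (ih (k + 1)))
        rw [Set.accumulate_succ, Set.preimage_union]
        refine (measureReal_mono fun y => ?_).trans (measureReal_union_le _ _)
        simp only [Set.mem_symmDiff, Set.mem_union]
        tauto
    have hacm (k : ℕ) : MeasurableSet (Set.accumulate f k) := by
      rw [Set.accumulate_def]
      exact MeasurableSet.biUnion (Set.to_countable _) fun i _ => hm i
    rw [Metric.tendsto_atTop]
    intro ε hε
    have hlim' : Tendsto (fun k => μ.real (Set.accumulate f k)) atTop (𝓝 (μ.real (⋃ i, f i))) :=
      (ENNReal.tendsto_toReal (measure_ne_top _ _)).comp tendsto_measure_iUnion_accumulate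
    obtain ⟨k, hk⟩ := (hlim'.eventually (lt_mem_nhds
      (show μ.real (⋃ i, f i) - ε / 3 < _ by linarith))).exists
    obtain ⟨N, hN⟩ := Metric.tendsto_atTop.1 (hacc k) (ε / 3) (by linarith)
    refine ⟨N, fun n hn => ?_⟩
    have hsub : Set.accumulate f k ⊆ ⋃ i, f i := Set.accumulate_subset_iUnion k
    have hdiff := measureReal_sdiff hsub (hacm k) (μ := μ)
    have hpre : μ.real (τ n ⁻¹' ((⋃ i, f i) \ Set.accumulate f k)) =
        μ.real ((⋃ i, f i) \ Set.accumulate f k) :=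
      (hτ n).measureReal_preimage ((MeasurableSet.iUnion hm).diff (hacm k)).nullMeasurableSet
    have hN' := hN n hn
    rw [dist_zero_right, Real.norm_of_nonneg measureReal_nonneg] at hN' ⊢
    have hle : μ.real ((τ n ⁻¹' ⋃ i, f i) ∆ ⋃ i, f i) ≤
        μ.real ((τ n ⁻¹' Set.accumulate f k) ∆ Set.accumulate f k) +
          μ.real (τ n ⁻¹' ((⋃ i, f i) \ Set.accumulate f k)) +
          μ.real ((⋃ i, f i) \ Set.accumulate f k) := by
      refine (measureReal_mono fun y => ?_).trans ((measureReal_union_le _ _).trans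
        (add_le_add_left (measureReal_union_le _ _) _))
      have := @hsub y
      have := @hsub (τ n y)
      simp only [Set.mem_symmDiff, Set.mem_union, Set.mem_preimage, Set.mem_sdiff]
      tauto
    linarith

end Continuity

/-! ### Invariant measures absolutely continuous with respect to an ergodic one -/

section ErgodicDensity

/-- A finite measure that is invariant and absolutely continuous with respect to an ergodic
measure is a multiple of it. -/
theorem eq_smul_of_ergodicSMul (G : Type*) {X : Type*} [Group G] [MulAction G X]
    [MeasurableSpace X] [MeasurableConstSMul G X] {ν κ : Measure X} [IsProbabilityMeasure ν]
    [IsFiniteMeasure κ] [ErgodicSMul G X ν] [SMulInvariantMeasure G X κ] (hκ : κ ≪ ν) :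
    κ = κ Set.univ • ν := by
  -- The density is invariant because both measures are, so its preimages of Borel sets are null or
  -- conull.
  obtain ⟨c, hc⟩ : ∃ c, κ.rnDeriv ν =ᵐ[ν] Function.const X c := by
    refine exists_eventuallyEq_const_of_forall_separating MeasurableSet fun U hU => ?_
    have h := aeconst_of_forall_preimage_smul_ae_eq G (μ := ν) (s := κ.rnDeriv ν ⁻¹' U)
      ((Measure.measurable_rnDeriv κ ν) hU).nullMeasurableSet fun g => by
        have := (measurePreserving_smul g κ).rnDeriv_comp_aeEq (measurePreserving_smul g ν)
        exact (this.mono fun x hx => by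
          change κ.rnDeriv ν (g • x) ∈ U ↔ κ.rnDeriv ν x ∈ U
          rw [← hx]; rfl).set_eq
    exact eventuallyConst_set.1 h
  have h : κ = c • ν := by
    rw [← Measure.withDensity_rnDeriv_eq κ ν hκ, withDensity_congr_ae hc]
    exact withDensity_const c
  conv_lhs => rw [h]
  congr 1
  rw [h]; simp

end ErgodicDensity

/-! ### Ergodicity of the product action -/

section Product

variable {X Y : Type*} [MeasurableSpace X] [MeasurableSpace Y]
  [MulAction CoverGroup X] [MulAction CoverGroup Y]
  [MeasurableConstSMul CoverGroup X] [MeasurableConstSMul CoverGroup Y]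
  (ν : Measure X) (μ : Measure Y) [IsProbabilityMeasure ν] [IsProbabilityMeasure μ]

lemma preimage_smul_preimage_smul {G Z : Type*} [Monoid G] [MulAction G Z] (g h : G) (S : Set Z) :
    (g • ·) ⁻¹' ((h • ·) ⁻¹' S) = ((h * g) • ·) ⁻¹' S := by
  ext z; simp [mul_smul]

lemma measureReal_inter_preimage_smul {G X Y : Type*} [Group G] [MeasurableSpace X]
    [MeasurableSpace Y] [MulAction G X] [MulAction G Y] [MeasurableConstSMul G X]
    [MeasurableConstSMul G Y] (ν : Measure X) (μ : Measure Y) [IsProbabilityMeasure ν]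
    [IsProbabilityMeasure μ] [SMulInvariantMeasure G X ν] [SMulInvariantMeasure G Y μ]
    {E : Set (X × Y)} (hE : MeasurableSet E) {g : G}
    (hg : (g • ·) ⁻¹' E =ᵐ[ν.prod μ] E) {B : Set X} (hB : MeasurableSet B) {A : Set Y}
    (hA : MeasurableSet A) :
    (ν.prod μ).real (E ∩ ((g • ·) ⁻¹' B) ×ˢ ((g • ·) ⁻¹' A)) = (ν.prod μ).real (E ∩ B ×ˢ A) := by
  have hmp : MeasurePreserving (g • · : X × Y → X × Y) (ν.prod μ) (ν.prod μ) :=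
    (measurePreserving_smul g ν).prod (measurePreserving_smul g μ)
  rw [← hmp.measureReal_preimage (hE.inter (hB.prod hA)).nullMeasurableSet]
  exact measureReal_congr (hg.symm.inter (ae_eq_refl _))

variable {ν μ}

/-- Mautner phenomenon: with aᵏu = u'aᵏ and u' close to 1, Φ(B, (aᵏu)⁻¹A) is close both to Φ(B,
u⁻¹A), by recurrence, and to Φ(B, a⁻ᵏA), by continuity; the latter is close to Φ(B, A). -/
theorem measureReal_inter_preimage_parabolic [SMulInvariantMeasure CoverGroup X ν]
    [SMulInvariantMeasure CoverGroup Y μ]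
    (hcont : ∀ t : ℕ → ℝ, Tendsto t atTop (𝓝 0) → ∀ A : Set Y, MeasurableSet A →
      Tendsto (fun n => μ.real (((CoverGroup.parabolic (t n) 0 • ·) ⁻¹' A) ∆ A)) atTop (𝓝 0))
    {E : Set (X × Y)} (hE : MeasurableSet E)
    (hinv : ∀ g : CoverGroup, (g • ·) ⁻¹' E =ᵐ[ν.prod μ] E)
    (t : ℝ) {B : Set X} (hB : MeasurableSet B) {A : Set Y} (hA : MeasurableSet A) :
    (ν.prod μ).real (E ∩ B ×ˢ ((CoverGroup.parabolic t 0 • ·) ⁻¹' A)) =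
      (ν.prod μ).real (E ∩ B ×ˢ A) := by
  set Φ : Set X → Set Y → ℝ := fun B A => (ν.prod μ).real (E ∩ B ×ˢ A) with hΦ
  have hΦinv (g : CoverGroup) {B : Set X} (hB : MeasurableSet B) {A : Set Y}
      (hA : MeasurableSet A) : Φ ((g • ·) ⁻¹' B) ((g • ·) ⁻¹' A) = Φ B A :=
    measureReal_inter_preimage_smul ν μ hE (hinv g) hB hA
  have hlip (B : Set X) {A A' : Set Y} (hA : MeasurableSet A) (hA' : MeasurableSet A') :
      |Φ B A - Φ B A'| ≤ μ.real (A ∆ A') := by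
    have key (A A' : Set Y) : Φ B A ≤ Φ B A' + μ.real (A ∆ A') := by
      have h1 : μ.real (A ∆ A') ≥ (ν.prod μ).real (Set.univ ×ˢ (A ∆ A')) := by
        rw [measureReal_prod_prod]; simp
      refine le_trans ?_ (add_le_add_right h1 _)
      refine (measureReal_mono fun p hp => ?_).trans (measureReal_union_le _ _)
      have := hp.1
      have := hp.2.1
      have := hp.2.2
      simp only [Set.mem_union, Set.mem_inter_iff, Set.mem_prod, Set.mem_symmDiff, Set.mem_univ]
      tauto
    have h1 := key A A'
    have h2 := key A' A
    rw [symmDiff_comm] at h2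
    rw [abs_le]; constructor <;> linarith
  set a := CoverGroup.hyperbolic (-1 / 2) with ha
  -- the powers of `a` are recurrent
  have hrec (ε : ℝ) (hε : 0 < ε) (K : ℕ) : ∃ k ≥ K, ∀ B : Set X, MeasurableSet B →
      |Φ B ((a ^ k • ·) ⁻¹' A) - Φ B A| ≤ ε := by
    obtain ⟨φ, hφ, h⟩ := rectPrecompact_prod ν μ hE ε hε fun n => (a ^ n • ·) ⁻¹' A
    -- Diagonal invariance strips the common power `φ 0` from the two terms, at the price of moving
    -- `B`; uniformity in `B` is essential here. The offset in the index makes the difference at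
    -- least `K`.
    refine ⟨φ (K + φ 0) - φ 0, ?_, fun B hB => ?_⟩
    · have := hφ.id_le (K + φ 0)
      simp only [id] at this
      omega
    · have hle : φ 0 ≤ φ (K + φ 0) := hφ.monotone (Nat.zero_le _)
      have h1 := h (K + φ 0) 0 ((a ^ φ 0 • ·) ⁻¹' B)
      have e : ((a ^ φ (K + φ 0) • ·) ⁻¹' A : Set Y) =
          (a ^ φ 0 • ·) ⁻¹' ((a ^ (φ (K + φ 0) - φ 0) • ·) ⁻¹' A) := by
        rw [preimage_smul_preimage_smul, ← pow_add, Nat.sub_add_cancel hle]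
      change |Φ _ _ - Φ _ _| ≤ ε at h1
      rwa [e, hΦinv _ hB (measurable_const_smul _ hA), hΦinv _ hB hA] at h1
  refine eq_of_forall_dist_le fun ε hε => ?_
  rw [Real.dist_eq]
  have hlim : Tendsto (fun k : ℕ => Real.exp (2 * (-1 / 2)) ^ k * t) atTop (𝓝 0) := by
    have := (tendsto_pow_atTop_nhds_zero_of_lt_one (Real.exp_pos (2 * (-1 / 2))).le
      (by rw [Real.exp_lt_one_iff]; norm_num)).mul_const t
    simpa using this
  obtain ⟨K, hK⟩ := Metric.tendsto_atTop.1 (hcont _ hlim A hA) (ε / 3) (by linarith)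
  obtain ⟨k, hk, hrk⟩ := hrec (ε / 3) (by linarith) K
  set u := CoverGroup.parabolic t 0 with hu
  set u' := CoverGroup.parabolic (Real.exp (2 * (-1 / 2)) ^ k * t) 0 with hu'
  have hcomm : a ^ k * u = u' * a ^ k := CoverGroup.hyperbolic_pow_mul_parabolic _ _ _
  have e0 := hK k hk
  rw [dist_zero_right, Real.norm_of_nonneg measureReal_nonneg] at e0
  have hcancel (g : CoverGroup) (S : Set X) : (g • ·) ⁻¹' ((g⁻¹ • ·) ⁻¹' S) = S := by
    rw [preimage_smul_preimage_smul]; simp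
  -- move `u` to the first variable, and back
  have hBu : MeasurableSet ((u⁻¹ • ·) ⁻¹' B) := measurable_const_smul _ hB
  have e1 : |Φ B ((u • ·) ⁻¹' ((a ^ k • ·) ⁻¹' A)) - Φ B ((u • ·) ⁻¹' A)| ≤ ε / 3 := by
    have h1 := hΦinv u hBu (measurable_const_smul (a ^ k) hA)
    have h2 := hΦinv u hBu hA
    rw [hcancel] at h1 h2
    rw [h1, h2]
    exact hrk _ hBu
  have hBa : MeasurableSet (((a ^ k)⁻¹ • ·) ⁻¹' B) := measurable_const_smul _ hB
  have e2 : |Φ B ((u • ·) ⁻¹' ((a ^ k • ·) ⁻¹' A)) - Φ B ((a ^ k • ·) ⁻¹' A)| ≤ ε / 3 := by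
    have h1 := hΦinv (a ^ k) hBa (measurable_const_smul u' hA)
    have h2 := hΦinv (a ^ k) hBa hA
    rw [hcancel] at h1 h2
    rw [preimage_smul_preimage_smul, hcomm, ← preimage_smul_preimage_smul, h1, h2]
    exact (hlip _ (measurable_const_smul u' hA) hA).trans e0.le
  have e3 := hrk B hB
  rw [abs_le] at e1 e2 e3 ⊢
  change -ε ≤ Φ _ _ - Φ _ _ ∧ Φ _ _ - Φ _ _ ≤ ε
  constructor <;> linarith [e1.1, e1.2, e2.1, e2.2, e3.1, e3.2]

/-- Invariant subsets of a product are invariant under each factor. -/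
theorem measureReal_inter_preimage_right [SMulInvariantMeasure CoverGroup X ν]
    [SMulInvariantMeasure CoverGroup Y μ]
    (hcont : ∀ t : ℕ → ℝ, Tendsto t atTop (𝓝 0) → ∀ A : Set Y, MeasurableSet A →
      Tendsto (fun n => μ.real (((CoverGroup.parabolic (t n) 0 • ·) ⁻¹' A) ∆ A)) atTop (𝓝 0))
    {E : Set (X × Y)} (hE : MeasurableSet E)
    (hinv : ∀ g : CoverGroup, (g • ·) ⁻¹' E =ᵐ[ν.prod μ] E)
    (g : CoverGroup) {B : Set X} (hB : MeasurableSet B) {A : Set Y} (hA : MeasurableSet A) :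
    (ν.prod μ).real (E ∩ B ×ˢ ((g • ·) ⁻¹' A)) = (ν.prod μ).real (E ∩ B ×ˢ A) := by
  let N : Subgroup CoverGroup :=
    { carrier := {g | ∀ B : Set X, MeasurableSet B → ∀ A : Set Y, MeasurableSet A →
        (ν.prod μ).real (E ∩ B ×ˢ ((g • ·) ⁻¹' A)) = (ν.prod μ).real (E ∩ B ×ˢ A)}
      mul_mem' := fun {g h} hg hh B hB A hA => by
        rw [← preimage_smul_preimage_smul, hh B hB _ (measurable_const_smul _ hA), hg B hB A hA]
      one_mem' := fun B _ A _ => by simp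
      inv_mem' := fun {g} hg B hB A hA => by
        rw [← hg B hB _ (measurable_const_smul _ hA), preimage_smul_preimage_smul]
        simp }
  -- Conjugation by `h` is absorbed by diagonal invariance, which moves `h` to both arguments.
  have hN : N.Normal := ⟨fun g hg h B hB A hA => by
    have hB' : MeasurableSet ((h • ·) ⁻¹' B) := measurable_const_smul _ hB
    have hA' : MeasurableSet ((h • ·) ⁻¹' A) := measurable_const_smul _ hA
    have h1 := hg _ hB' _ hA'
    rw [measureReal_inter_preimage_smul ν μ hE (hinv h) hB hA] at h1
    rw [← h1, ← measureReal_inter_preimage_smul ν μ hE (hinv h) hB (measurable_const_smul _ hA),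
      preimage_smul_preimage_smul, preimage_smul_preimage_smul]
    congr 6
    simp [mul_assoc]⟩
  have htop : N = ⊤ := CoverGroup.eq_top_of_parabolic_mem N fun t B hB A hA =>
    measureReal_inter_preimage_parabolic hcont hE hinv t hB hA
  have : g ∈ N := htop ▸ Subgroup.mem_top g
  exact this B hB A hA

/-- The product of two ergodic actions of the covering group is ergodic, if one of them is
measurably continuous along the one-parameter group of parabolic elements. -/
theorem ergodicSMul_prod [ErgodicSMul CoverGroup X ν] [ErgodicSMul CoverGroup Y μ]
    (hcont : ∀ t : ℕ → ℝ, Tendsto t atTop (𝓝 0) → ∀ A : Set Y, MeasurableSet A →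
      Tendsto (fun n => μ.real (((CoverGroup.parabolic (t n) 0 • ·) ⁻¹' A) ∆ A)) atTop (𝓝 0)) :
    ErgodicSMul CoverGroup (X × Y) (ν.prod μ) where
  measure_preimage_smul c s hs :=
    ((measurePreserving_smul c ν).prod (measurePreserving_smul c μ)).measure_preimage
      hs.nullMeasurableSet
  aeconst_of_forall_preimage_smul_ae_eq {E} hE hinv := by
    set κ := ν.prod μ with hκ
    have hY (g : CoverGroup) {B : Set X} (hB : MeasurableSet B) {A : Set Y}
        (hA : MeasurableSet A) : κ (E ∩ B ×ˢ ((g • ·) ⁻¹' A)) = κ (E ∩ B ×ˢ A) :=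
      (measureReal_eq_measureReal_iff).1
        (measureReal_inter_preimage_right hcont hE hinv g hB hA)
    have hX (g : CoverGroup) {B : Set X} (hB : MeasurableSet B) {A : Set Y}
        (hA : MeasurableSet A) : κ (E ∩ ((g • ·) ⁻¹' B) ×ˢ A) = κ (E ∩ B ×ˢ A) := by
      rw [← hY g (measurable_const_smul _ hB) hA]
      exact (measureReal_eq_measureReal_iff).1
        (measureReal_inter_preimage_smul ν μ hE (hinv g) hB hA)
    have key {B : Set X} (hB : MeasurableSet B) {A : Set Y} (hA : MeasurableSet A) :
        κ (E ∩ B ×ˢ A) = κ E * (ν B * μ A) := by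
      -- With `A` fixed, the left side is a finite measure in `B`, dominated by ν and invariant by
      -- `hX`, hence a multiple of ν.
      have h1 : κ (E ∩ B ×ˢ A) = κ (E ∩ Set.univ ×ˢ A) * ν B := by
        let η : Measure X := (κ.restrict (E ∩ Set.univ ×ˢ A)).map Prod.fst
        have hη {B : Set X} (hB : MeasurableSet B) : η B = κ (E ∩ B ×ˢ A) := by
          rw [Measure.map_apply measurable_fst hB, Measure.restrict_apply (measurable_fst hB)]
          congr 1; ext p; simp; tauto
        have hac : η ≪ ν := by
          refine Measure.AbsolutelyContinuous.mk fun s hs h0 => ?_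
          rw [hη hs]
          refine measure_mono_null Set.inter_subset_right ?_
          rw [hκ, Measure.prod_prod, h0, zero_mul]
        have : SMulInvariantMeasure CoverGroup X η := ⟨fun c s hs => by
          rw [hη hs, hη (measurable_const_smul c hs), hX c hs hA]⟩
        have h := congrArg (fun m => m B) (eq_smul_of_ergodicSMul CoverGroup hac)
        simpa [hη hB, hη MeasurableSet.univ] using h
      have h2 : κ (E ∩ Set.univ ×ˢ A) = κ E * μ A := by
        let η : Measure Y := (κ.restrict E).map Prod.snd
        have hη {A : Set Y} (hA : MeasurableSet A) : η A = κ (E ∩ Set.univ ×ˢ A) := by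
          rw [Measure.map_apply measurable_snd hA, Measure.restrict_apply (measurable_snd hA)]
          congr 1; ext p; simp; tauto
        have hac : η ≪ μ := by
          refine Measure.AbsolutelyContinuous.mk fun s hs h0 => ?_
          rw [hη hs]
          refine measure_mono_null Set.inter_subset_right ?_
          rw [hκ, Measure.prod_prod, h0, mul_zero]
        have : SMulInvariantMeasure CoverGroup Y η := ⟨fun c s hs => by
          rw [hη hs, hη (measurable_const_smul c hs), hY c MeasurableSet.univ hs]⟩
        have h := congrArg (fun m => m A) (eq_smul_of_ergodicSMul CoverGroup hac)
        simpa [hη hA, hη MeasurableSet.univ] using h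
      rw [h1, h2]; ring
    have hrestr : κ.restrict E = κ E • κ := by
      refine MeasureTheory.ext_of_generate_finite _ generateFrom_prod.symm isPiSystem_prod ?_ ?_
      · rintro _ ⟨B, hB, A, hA, rfl⟩
        rw [Measure.restrict_apply (MeasurableSet.prod hB hA), Set.inter_comm, key hB hA,
          Measure.smul_apply, hκ, Measure.prod_prod, smul_eq_mul]
      · simp
    -- The restriction of κ to `E` has no mass on the complement.
    have preimage_smul_preimage_smull : κ E * κ Eᶜ = 0 := by
      have := congrArg (fun m => m Eᶜ) hrestr
      simpa [Measure.restrict_apply hE.compl] using this.symm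
    rw [eventuallyConst_set]
    rcases mul_eq_zero.1 preimage_smul_preimage_smull with h | h
    · right; exact measure_eq_zero_iff_ae_notMem.1 h
    · left; exact (measure_eq_zero_iff_ae_notMem.1 h).mono fun x hx => by simpa using hx

end Product

/-! ### The Polish space of holomorphic differentials and its continuous action -/

section UnitDisc

lemma isOpenEmbedding_unitDisc_coe : IsOpenEmbedding ((↑) : 𝔻 → ℂ) := by
  refine ⟨Complex.UnitDisc.isEmbedding_coe, ?_⟩
  have : Set.range ((↑) : 𝔻 → ℂ) = Metric.ball 0 1 := by
    ext z
    refine ⟨?_, fun hz => ⟨.mk z (mem_ball_zero_iff.1 hz), Complex.UnitDisc.coe_mk _ _⟩⟩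
    rintro ⟨w, rfl⟩
    exact mem_ball_zero_iff.2 w.norm_lt_one
  rw [this]
  exact Metric.isOpen_ball

instance : LocallyCompactSpace 𝔻 := isOpenEmbedding_unitDisc_coe.locallyCompactSpace

instance : SecondCountableTopology 𝔻 :=
  Complex.UnitDisc.isEmbedding_coe.secondCountableTopology

end UnitDisc

lemma tendstoLocallyUniformlyOn_extendZero {ι : Type*} {l : Filter ι} {F : ι → 𝔻 → ℂ} {f : 𝔻 → ℂ}
    (h : TendstoLocallyUniformly F f l) :
    TendstoLocallyUniformlyOn (fun i => extendZero (F i)) (extendZero f) l (Metric.ball 0 1) := by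
  intro u hu x hx
  rw [mem_ball_zero_iff] at hx
  obtain ⟨t, ht, hF⟩ := h u hu (.mk x hx)
  refine ⟨((↑) : 𝔻 → ℂ) '' t, mem_nhdsWithin_of_mem_nhds ?_, hF.mono fun n hn => ?_⟩
  · have := isOpenEmbedding_unitDisc_coe.isOpenMap.image_mem_nhds ht
    rwa [Complex.UnitDisc.coe_mk] at this
  · rintro _ ⟨y, hy, rfl⟩
    simpa using hn y hy

/-- Weierstrass: locally uniform limits of holomorphic functions are holomorphic. -/
lemma isClosed_holomorphicSubmodule : IsClosed (holomorphicSubmodule : Set C(𝔻, ℂ)) := by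
  refine isClosed_of_closure_subset fun f hf => ?_
  rw [mem_closure_iff_comap_neBot] at hf
  have h := ContinuousMap.tendsto_iff_tendstoLocallyUniformly.1
    (tendsto_comap (f := ((↑) : holomorphicSubmodule → C(𝔻, ℂ))) (x := 𝓝 f))
  exact (tendstoLocallyUniformlyOn_extendZero h).differentiableOn
    (Eventually.of_forall fun θ => θ.2) Metric.isOpen_ball

namespace HolDifferential

variable {m n : ℝ}

instance : PolishSpace (HolDifferential m) := isClosed_holomorphicSubmodule.polishSpace

lemma continuous_eval {T : Type*} [TopologicalSpace T] {θ : T → HolDifferential m}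
    (hθ : Continuous θ) {z : T → 𝔻} (hz : Continuous z) : Continuous fun t => θ t (z t) := by
  have : Continuous fun t => (θ t).1 := continuous_subtype_val.comp hθ
  exact this.eval hz

lemma continuous_of_uncurry {T : Type*} [TopologicalSpace T] {θ : T → HolDifferential m}
    (h : Continuous fun p : T × 𝔻 => θ p.1 p.2) : Continuous θ :=
  Continuous.subtype_mk (p := fun f => f ∈ holomorphicSubmodule)
    (ContinuousMap.continuous_of_continuous_uncurry (fun t => (θ t).1) h) fun t => (θ t).2

instance : ContinuousAdd (HolDifferential m) where
  continuous_add := continuous_of_uncurry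
    ((continuous_eval (m := m) (continuous_fst.comp continuous_fst) continuous_snd).add
      (continuous_eval (m := m) (continuous_snd.comp continuous_fst) continuous_snd))

/-- Continuity of the three entries replaces a topology on the group. The factor is the exponential
of -2m times a logarithm that is jointly continuous, since 1 - (b̄/a)z stays in the right
half-plane. -/
lemma continuous_smul_of_continuous {T : Type*} [TopologicalSpace T] {γ : T → CoverGroup}
    (ha : Continuous fun t => (γ t).a) (hb : Continuous fun t => (γ t).b)
    (hA : Continuous fun t => (γ t).A) {θ : T → HolDifferential m} (hθ : Continuous θ) :
    Continuous fun t => γ t • θ t := by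
  refine continuous_of_uncurry ?_
  have hz : Continuous fun p : T × 𝔻 => (p.2 : ℂ) :=
    Complex.UnitDisc.continuous_coe.comp continuous_snd
  have ha' : Continuous fun p : T × 𝔻 => (γ p.1).a := ha.comp continuous_fst
  have hb' : Continuous fun p : T × 𝔻 => (γ p.1).b := hb.comp continuous_fst
  have hA' : Continuous fun p : T × 𝔻 => (γ p.1).A := hA.comp continuous_fst
  have hw : Continuous fun p : T × 𝔻 =>
      Complex.UnitDisc.mk ((γ p.1).moebiusInv p.2) ((γ p.1).norm_moebiusInv_lt p.2.norm_lt_one) := by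
    rw [Complex.UnitDisc.isEmbedding_coe.continuous_iff]
    simp only [Function.comp_def, Complex.UnitDisc.coe_mk, CoverGroup.moebiusInv]
    refine Continuous.div ?_ ?_ fun p => (γ p.1).denom_ne_zero p.2.norm_lt_one
    · exact ((Complex.continuous_conj.comp ha').mul hz).sub hb'
    · exact ((Complex.continuous_conj.comp hb').neg.mul hz).add ha'
  have hlog : Continuous fun p : T × 𝔻 => (γ p.1).logDenom p.2 := by
    simp only [CoverGroup.logDenom]
    refine hA'.add (Continuous.clog ?_ fun p => Or.inl ((γ p.1).re_factor_pos p.2.norm_lt_one))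
    exact continuous_const.sub (((Complex.continuous_conj.comp hb').div ha'
      fun p => (γ p.1).a_ne_zero).mul hz)
  have key : (fun p : T × 𝔻 => (γ p.1 • θ p.1) p.2) = fun p : T × 𝔻 =>
      θ p.1 (Complex.UnitDisc.mk ((γ p.1).moebiusInv p.2)
        ((γ p.1).norm_moebiusInv_lt p.2.norm_lt_one)) *
      Complex.exp (-2 * m * (γ p.1).logDenom p.2) := by
    funext p
    rw [smul_apply, CoverGroup.act, CoverGroup.factor_eq _ _ p.2.norm_lt_one,
      extendZero_of_lt _ ((γ p.1).norm_moebiusInv_lt p.2.norm_lt_one)]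
  rw [key]
  exact (continuous_eval (hθ.comp continuous_fst) hw).mul
    (Complex.continuous_exp.comp (continuous_const.mul hlog))

instance : MeasurableConstSMul CoverGroup (HolDifferential m) where
  measurable_const_smul g := (continuous_smul_of_continuous (γ := fun _ => g) continuous_const
    continuous_const continuous_const continuous_id).measurable

lemma continuous_parabolic_smul (θ : HolDifferential m) :
    Continuous fun t : ℝ => CoverGroup.parabolic t 0 • θ := by
  refine continuous_smul_of_continuous ?_ ?_ ?_ continuous_const
  · exact continuous_const.add (Complex.continuous_ofReal.mul continuous_const)
  · exact Complex.continuous_ofReal.mul continuous_const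
  · exact Continuous.clog (continuous_const.add (Complex.continuous_ofReal.mul continuous_const))
      fun t => Or.inl (by simp)

lemma parabolic_zero : CoverGroup.parabolic 0 0 = 1 := by
  ext <;> simp [CoverGroup.parabolic]

theorem tendsto_measureReal_parabolic {μ : Measure (HolDifferential m)} [IsProbabilityMeasure μ]
    [SMulInvariantMeasure CoverGroup (HolDifferential m) μ]
    (t : ℕ → ℝ) (ht : Tendsto t atTop (𝓝 0)) (A : Set (HolDifferential m)) (hA : MeasurableSet A) :
    Tendsto (fun n => μ.real (((CoverGroup.parabolic (t n) 0 • ·) ⁻¹' A) ∆ A)) atTop (𝓝 0) := by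
  refine tendsto_measureReal_preimage_symmDiff μ (fun n => measurePreserving_smul _ μ)
    (fun θ => ?_) hA
  have := ((continuous_parabolic_smul θ).tendsto 0).comp ht
  rwa [parabolic_zero, one_smul] at this

lemma continuous_mul :
    Continuous fun p : HolDifferential m × HolDifferential n => p.1.mul p.2 := by
  refine continuous_of_uncurry ?_
  exact (continuous_eval (continuous_fst.comp continuous_fst) continuous_snd).mul
    (continuous_eval (continuous_snd.comp continuous_fst) continuous_snd)

lemma add_apply (θ θ' : HolDifferential m) (z : 𝔻) : (θ + θ') z = θ z + θ' z := rfl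

lemma smul_add' (g : CoverGroup) (θ θ' : HolDifferential m) : g • (θ + θ') = g • θ + g • θ' := by
  ext z
  have hw := g.norm_moebiusInv_lt z.norm_lt_one
  simp only [add_apply, smul_apply, CoverGroup.act, extendZero_of_lt _ hw]
  ring

lemma factor_add (g : CoverGroup) (m n : ℝ) (z : 𝔻) :
    g.factor (m + n) z = g.factor m z * g.factor n z := by
  simp only [CoverGroup.factor_eq _ _ z.norm_lt_one, ← Complex.exp_add]
  congr 1; push_cast; ring

lemma factor_sub (g : CoverGroup) (m n : ℝ) (z : 𝔻) :
    g.factor (m - n) z = g.factor m z / g.factor n z := by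
  simp only [CoverGroup.factor_eq _ _ z.norm_lt_one, ← Complex.exp_sub]
  congr 1; push_cast; ring

lemma factor_ne_zero (g : CoverGroup) (m : ℝ) (z : 𝔻) : g.factor m z ≠ 0 := by
  rw [CoverGroup.factor_eq _ _ z.norm_lt_one]; exact Complex.exp_ne_zero _

lemma smul_mul (g : CoverGroup) (θ : HolDifferential m) (θ' : HolDifferential n) :
    g • θ.mul θ' = (g • θ).mul (g • θ') := by
  ext z
  have hw := g.norm_moebiusInv_lt z.norm_lt_one
  simp only [smul_apply, CoverGroup.act, extendZero_of_lt _ hw, mul, mk_apply, factor_add]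
  ring

lemma smul_ne_zero_of (g : CoverGroup) {θ : HolDifferential m} (h : ∀ z, θ z ≠ 0) (z : 𝔻) :
    (g • θ) z ≠ 0 := by
  have hw := g.norm_moebiusInv_lt z.norm_lt_one
  simp only [smul_apply, CoverGroup.act, extendZero_of_lt _ hw]
  exact mul_ne_zero (h _) (factor_ne_zero _ _ _)

lemma smul_ne_zero_iff (g : CoverGroup) {θ : HolDifferential m} :
    (∀ z, (g • θ) z ≠ 0) ↔ ∀ z, θ z ≠ 0 :=
  ⟨fun h => by simpa using smul_ne_zero_of g⁻¹ h, smul_ne_zero_of g⟩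

lemma quot_apply {θ : HolDifferential m} {θ' : HolDifferential n} (h : ∀ z, θ' z ≠ 0) (z : 𝔻) :
    θ.quot θ' z = θ z / θ' z := by
  simp only [quot, dif_pos h, mk_apply]

lemma smul_zero' (g : CoverGroup) : g • (0 : HolDifferential m) = 0 := by
  ext z
  have hw := g.norm_moebiusInv_lt z.norm_lt_one
  simp only [smul_apply, CoverGroup.act, extendZero_of_lt _ hw]
  change 0 * _ = (0 : ℂ)
  rw [zero_mul]

/-- Having no zeros is invariant, and the default value 0 is fixed by the group, so equivariance
holds at every pair. -/
lemma smul_quot (g : CoverGroup) (θ : HolDifferential m) (θ' : HolDifferential n) :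
    g • θ.quot θ' = (g • θ).quot (g • θ') := by
  by_cases h : ∀ z, θ' z ≠ 0
  · ext z
    have hw := g.norm_moebiusInv_lt z.norm_lt_one
    rw [quot_apply ((smul_ne_zero_iff g).2 h)]
    simp only [smul_apply, CoverGroup.act, extendZero_of_lt _ hw, quot_apply h, factor_sub]
    rw [div_mul_div_comm]
  · rw [quot, quot, dif_neg h, dif_neg (mt (smul_ne_zero_iff g).1 h), smul_zero']

/-- Being zero-free on a compact set is an open condition; a countable exhaustion gives a Gδ set. -/
lemma measurableSet_ne_zero : MeasurableSet {θ : HolDifferential n | ∀ z, θ z ≠ 0} := by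
  have h : {θ : HolDifferential n | ∀ z, θ z ≠ 0} =
      ⋂ k : ℕ, {θ | Set.MapsTo θ.1 (compactCovering 𝔻 k) {0}ᶜ} := by
    ext θ
    simp only [Set.mem_ofPred_eq, Set.mem_iInter]
    refine ⟨fun h k z _ => h z, fun h z => ?_⟩
    obtain ⟨k, hk⟩ := exists_mem_compactCovering z
    exact h k hk
  rw [h]
  refine MeasurableSet.iInter fun k => IsOpen.measurableSet ?_
  exact (ContinuousMap.isOpen_setOfPred_mapsTo (isCompact_compactCovering 𝔻 k)
    isOpen_compl_singleton).preimage continuous_subtype_val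

lemma measurable_quot :
    Measurable fun p : HolDifferential m × HolDifferential n => p.1.quot p.2 := by
  set s : Set (HolDifferential m × HolDifferential n) := {p | ∀ z, p.2 z ≠ 0} with hs
  have hsm : MeasurableSet s := measurable_snd measurableSet_ne_zero
  refine measurable_of_restrict_of_restrict_compl hsm ?_ ?_
  · refine Continuous.measurable (continuous_of_uncurry ?_)
    have : (fun p : s × 𝔻 => (s.domRestrict (fun p => p.1.quot p.2) p.1 : HolDifferential (m - n)) p.2)
        = fun p : s × 𝔻 => p.1.1.1 p.2 / p.1.1.2 p.2 := by
      funext p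
      exact quot_apply p.1.2 p.2
    rw [this]
    refine Continuous.div ?_ ?_ fun p => p.1.2 p.2
    · exact continuous_eval (continuous_fst.comp (continuous_subtype_val.comp continuous_fst))
        continuous_snd
    · exact continuous_eval (continuous_snd.comp (continuous_subtype_val.comp continuous_fst))
        continuous_snd
  · refine measurable_const' (f := (sᶜ).domRestrict fun p => p.1.quot p.2) fun p q => ?_
    change p.1.1.quot p.1.2 = q.1.1.quot q.1.2
    have hp : ¬ ∀ z, p.1.2 z ≠ 0 := p.2
    have hq : ¬ ∀ z, q.1.2 z ≠ 0 := q.2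
    rw [quot, quot, dif_neg hp, dif_neg hq]

end HolDifferential

/-! ### Equivariant images of ergodic measures -/

lemma ergodicSMul_map {G Z W : Type*} [SMul G Z] [SMul G W] [MeasurableSpace Z]
    [MeasurableSpace W] [MeasurableConstSMul G W] {κ : Measure Z} [ErgodicSMul G Z κ] {F : Z → W}
    (hF : Measurable F) (hsmul : ∀ (g : G) z, F (g • z) = g • F z) :
    ErgodicSMul G W (κ.map F) where
  measure_preimage_smul g s hs := by
    have e : F ⁻¹' ((g • ·) ⁻¹' s) = (g • ·) ⁻¹' (F ⁻¹' s) := by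
      ext z
      change g • F z ∈ s ↔ F (g • z) ∈ s
      rw [hsmul]
    rw [Measure.map_apply hF hs, Measure.map_apply hF (measurable_const_smul g hs), e,
      SMulInvariantMeasure.measure_preimage_smul g (hF hs)]
  aeconst_of_forall_preimage_smul_ae_eq {s} hs h := by
    have h1 : EventuallyConst (F ⁻¹' s) (ae κ) := by
      refine ErgodicSMul.aeconst_of_forall_preimage_smul_ae_eq (G := G) (hF hs) fun g => ?_
      have := hF.quasiMeasurePreserving κ |>.preimage_ae_eq (h g)
      refine EventuallyEq.trans (Eq.eventuallyEq ?_) this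
      ext z
      change F (g • z) ∈ s ↔ g • F z ∈ s
      rw [hsmul]
    rw [eventuallyConst_set] at h1 ⊢
    exact h1.imp (fun h => (ae_map_iff hF.aemeasurable hs).2 h)
      fun h => (ae_map_iff hF.aemeasurable hs.compl).2 h

section Images

variable {m n : ℝ}

theorem IsErgodicInvariant.ergodicSMul_prod {ν : Measure (HolDifferential m)}
    {μ : Measure (HolDifferential n)} (hν : IsErgodicInvariant ν) (hμ : IsErgodicInvariant μ) :
    ErgodicSMul CoverGroup (HolDifferential m × HolDifferential n) (ν.prod μ) := by
  have := hν.isProbabilityMeasure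
  have := hμ.isProbabilityMeasure
  have := hν.ergodicSMul
  have := hμ.ergodicSMul
  exact ConformalMeasures.ergodicSMul_prod HolDifferential.tendsto_measureReal_parabolic

theorem IsErgodicInvariant.map_prod {k : ℝ} {ν : Measure (HolDifferential m)}
    {μ : Measure (HolDifferential n)} (hν : IsErgodicInvariant ν) (hμ : IsErgodicInvariant μ)
    {F : HolDifferential m × HolDifferential n → HolDifferential k} (hF : Measurable F)
    (hsmul : ∀ (g : CoverGroup) p, F (g • p) = g • F p) :
    IsErgodicInvariant ((ν.prod μ).map F) := by
  have := hν.isProbabilityMeasure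
  have := hμ.isProbabilityMeasure
  have := hν.ergodicSMul_prod hμ
  exact ⟨Measure.isProbabilityMeasure_map hF.aemeasurable, ergodicSMul_map hF hsmul⟩

theorem IsErgodicInvariant.conv {ν μ : Measure (HolDifferential m)} (hν : IsErgodicInvariant ν)
    (hμ : IsErgodicInvariant μ) : IsErgodicInvariant (ν.conv μ) :=
  hν.map_prod hμ measurable_add fun g p => (HolDifferential.smul_add' g p.1 p.2).symm

theorem IsErgodicInvariant.mulImage {ν : Measure (HolDifferential m)}
    {μ : Measure (HolDifferential n)} (hν : IsErgodicInvariant ν) (hμ : IsErgodicInvariant μ) :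
    IsErgodicInvariant (mulImage ν μ) :=
  hν.map_prod hμ HolDifferential.continuous_mul.measurable
    fun g p => (HolDifferential.smul_mul g p.1 p.2).symm

theorem IsErgodicInvariant.quotImage {ν : Measure (HolDifferential m)}
    {μ : Measure (HolDifferential n)} (hν : IsErgodicInvariant ν) (hμ : IsErgodicInvariant μ) :
    IsErgodicInvariant (quotImage ν μ) :=
  hν.map_prod hμ HolDifferential.measurable_quot
    fun g p => (HolDifferential.smul_quot g p.1 p.2).symm

end Images

/-! ### Almost-everywhere statements under image measures -/

section ImageMeasure

/-- By inner regularity, almost all of the good set is a countable union of compact sets. Their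
images are compact, hence Borel, and form a conull set on which `P` holds. -/
lemma ae_map_of_continuous {Z W : Type*} [TopologicalSpace Z] [PolishSpace Z] [MeasurableSpace Z]
    [BorelSpace Z] [TopologicalSpace W] [T2Space W] [MeasurableSpace W] [BorelSpace W]
    {κ : Measure Z} [IsFiniteMeasure κ] {q : Z → W} (hq : Continuous q) {P : W → Prop}
    (h : ∀ᵐ z ∂κ, P (q z)) : ∀ᵐ w ∂κ.map q, P w := by
  set N := toMeasurable κ {z | ¬ P (q z)} with hN
  have hN0 : κ N = 0 := by rw [measure_toMeasurable]; exact ae_iff.1 h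
  have hNP (z : Z) (hz : z ∉ N) : P (q z) := by
    by_contra hc
    exact hz (subset_toMeasurable κ _ hc)
  have hNm : MeasurableSet Nᶜ := (measurableSet_toMeasurable _ _).compl
  have hK (n : ℕ) : ∃ K ⊆ Nᶜ, IsCompact K ∧ κ (Nᶜ \ K) < ((n : ENNReal) + 1)⁻¹ :=
    hNm.exists_isCompact_sdiff_lt (measure_ne_top _ _) (by simp)
  choose K hKN hKc hKlt using hK
  have hL : MeasurableSet (⋃ n, q '' K n) :=
    MeasurableSet.iUnion fun n => ((hKc n).image hq).isClosed.measurableSet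
  rw [ae_iff]
  refine measure_mono_null (t := (⋃ n, q '' K n)ᶜ) (fun w hw hwL => hw ?_) ?_
  · obtain ⟨n, z, hz, rfl⟩ := Set.mem_iUnion.1 hwL
    exact hNP z (hKN n hz)
  · rw [Measure.map_apply hq.measurable hL.compl]
    have hle (n : ℕ) : κ (q ⁻¹' (⋃ n, q '' K n)ᶜ) ≤ ((n : ENNReal) + 1)⁻¹ := by
      calc κ (q ⁻¹' (⋃ n, q '' K n)ᶜ) ≤ κ (N ∪ (Nᶜ \ K n)) := by
            refine measure_mono fun z hz => ?_
            by_cases hzN : z ∈ N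
            · exact Or.inl hzN
            · exact Or.inr ⟨hzN, fun hzK => hz (Set.mem_iUnion.2 ⟨n, z, hzK, rfl⟩)⟩
        _ ≤ κ N + κ (Nᶜ \ K n) := measure_union_le _ _
        _ ≤ _ := by rw [hN0, zero_add]; exact (hKlt n).le
    have hlim : Tendsto (fun n : ℕ => ((n : ENNReal) + 1)⁻¹) atTop (𝓝 0) := by
      have := (tendsto_add_atTop_iff_nat 1).2 ENNReal.tendsto_inv_nat_nhds_zero
      simpa using this
    exact le_antisymm (ge_of_tendsto' hlim hle) zero_le

/-- A property, possibly non-measurable, that holds almost everywhere upstairs holds almost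
everywhere for the image measure. -/
theorem ae_map_of_ae_comp {Z W : Type*} [mZ : MeasurableSpace Z] [StandardBorelSpace Z]
    [MeasurableSpace W] [StandardBorelSpace W] {κ : Measure Z} [IsFiniteMeasure κ] {q : Z → W}
    (hq : Measurable q) {P : W → Prop} (h : ∀ᵐ z ∂κ, P (q z)) : ∀ᵐ w ∂κ.map q, P w := by
  let := upgradeStandardBorel W
  let tZ := upgradeStandardBorel Z
  -- A finer Polish topology makes `q` continuous without changing the Borel sets.
  obtain ⟨t', hle, hc, hp⟩ := hq.exists_continuous
  have hb : @BorelSpace Z t' mZ := by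
    refine @BorelSpace.mk Z t' mZ ?_
    rw [@borel_eq_borel_of_le Z t' tZ.toTopologicalSpace hp tZ.toPolishSpace hle]
    exact BorelSpace.measurable_eq
  exact @ae_map_of_continuous Z W t' hp mZ hb _ _ _ _ κ _ q hc P h

end ImageMeasure

/-! ### Formal differentials, Taylor series and their translates -/

namespace FormalDifferential

variable {k m n : ℝ}

/-- The identification of formal differentials with the sequences of their coefficients. -/
def coeffEquiv (k : ℝ) : FormalDifferential k ≃ᵐ (ℕ → ℂ) where
  toFun F i := F.coeff i
  invFun c := PowerSeries.mk c
  left_inv F := PowerSeries.ext fun i => PowerSeries.coeff_mk i _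
  right_inv c := funext fun i => PowerSeries.coeff_mk i c
  measurable_toFun := measurable_pi_lambda _ fun i =>
    Measurable.of_comap_le (le_iSup (fun i => MeasurableSpace.comap (coeff i) _) i)
  measurable_invFun := by
    refine Measurable.of_comap_le ?_
    change MeasurableSpace.comap _ (⨆ i : ℕ, MeasurableSpace.comap (coeff i) _) ≤ _
    rw [MeasurableSpace.comap_iSup]
    refine iSup_le fun i => ?_
    rw [MeasurableSpace.comap_comp]
    refine (le_of_eq (congrArg (fun f => MeasurableSpace.comap f inferInstance)
      (?_ : _ = fun c : ℕ → ℂ => c i))).trans (measurable_pi_apply i).comap_le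
    exact funext fun c => PowerSeries.coeff_mk i c

instance : StandardBorelSpace (FormalDifferential k) := by
  let t : TopologicalSpace (FormalDifferential k) := .induced (coeffEquiv k) inferInstance
  refine ⟨t, ⟨?_⟩, ?_⟩
  · have h : (MeasurableSpace.pi : MeasurableSpace (ℕ → ℂ)) = borel (ℕ → ℂ) :=
      BorelSpace.measurable_eq
    exact (coeffEquiv k).measurableEmbedding.comap_eq.symm.trans
      ((congrArg (MeasurableSpace.comap (coeffEquiv k)) h).trans borel_comap.symm)
  · exact ((coeffEquiv k).toEquiv.toHomeomorphOfIsInducing ⟨rfl⟩).isClosedEmbedding.polishSpace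

lemma measurable_of_coeff {Z : Type*} [MeasurableSpace Z] {q : Z → FormalDifferential k}
    (h : ∀ i, Measurable fun z => (q z).coeff i) : Measurable q := by
  have : Measurable fun z => coeffEquiv k (q z) := measurable_pi_lambda _ h
  simpa [Function.comp_def] using (coeffEquiv k).symm.measurable.comp this

lemma taylor_congr {f g : ℂ → ℂ} (h : f =ᶠ[𝓝 0] g) : taylor k f = taylor k g := by
  refine PowerSeries.ext fun i => ?_
  simp only [taylor, PowerSeries.coeff_mk, h.iteratedDeriv_eq]

lemma eventuallyEq_of_taylor_eq {f g : ℂ → ℂ} (hf : AnalyticAt ℂ f 0) (hg : AnalyticAt ℂ g 0)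
    (h : taylor k f = taylor k g) : f =ᶠ[𝓝 0] g := by
  have h1 := hf.hasFPowerSeriesAt
  have h2 := hg.hasFPowerSeriesAt
  have e : (fun n => iteratedDeriv n f 0 / (n.factorial : ℂ)) =
      fun n => iteratedDeriv n g 0 / (n.factorial : ℂ) := by
    funext n
    have := congrArg (PowerSeries.coeff n) h
    simpa only [taylor, PowerSeries.coeff_mk] using this
  rw [e] at h1
  have h3 := h1.sub h2
  rw [sub_self] at h3
  filter_upwards [h3.eventually_eq_zero] with z hz
  simpa [sub_eq_zero] using hz

lemma taylor_mul {f g : ℂ → ℂ} (hf : AnalyticAt ℂ f 0) (hg : AnalyticAt ℂ g 0) :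
    (taylor (m + n) (f * g)).toPowerSeries =
      (taylor m f).toPowerSeries * (taylor n g).toPowerSeries := by
  refine PowerSeries.ext fun i => ?_
  rw [PowerSeries.coeff_mul, Finset.Nat.sum_antidiagonal_eq_sum_range_succ_mk]
  simp only [toPowerSeries, taylor, PowerSeries.coeff_mk]
  rw [iteratedDeriv_mul hf.contDiffAt hg.contDiffAt, Finset.sum_div]
  refine Finset.sum_congr rfl fun j hj => ?_
  have hj : j ≤ i := Nat.lt_succ_iff.1 (Finset.mem_range.1 hj)
  rw [Nat.cast_choose ℂ hj]
  have h1 : (i.factorial : ℂ) ≠ 0 := by exact_mod_cast i.factorial_ne_zero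
  have h2 : (j.factorial : ℂ) ≠ 0 := by exact_mod_cast j.factorial_ne_zero
  have h3 : ((i - j).factorial : ℂ) ≠ 0 := by exact_mod_cast (i - j).factorial_ne_zero
  field_simp

lemma taylor_div {f g : ℂ → ℂ} (hf : AnalyticAt ℂ f 0) (hg : AnalyticAt ℂ g 0) (h0 : g 0 ≠ 0) :
    taylor (m - n) (f / g) = (taylor m f).quot (taylor n g) := by
  have hc : PowerSeries.constantCoeff (taylor n g).toPowerSeries ≠ 0 := by
    rw [← PowerSeries.coeff_zero_eq_constantCoeff_apply]
    simpa [toPowerSeries, taylor] using h0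
  refine (PowerSeries.eq_mul_inv_iff_mul_eq hc).2 ?_
  refine (taylor_mul (m := m - n) (hf.div hg h0) hg).symm.trans ?_
  refine taylor_congr (k := m) ?_
  filter_upwards [hg.continuousAt.eventually_ne h0] with z hz
  simp [hz]

end FormalDifferential

namespace CoverGroup

variable (g : CoverGroup)

lemma analyticAt_moebiusInv {z : ℂ} (hz : ‖z‖ < 1) : AnalyticAt ℂ g.moebiusInv z :=
  AnalyticAt.div (by fun_prop) (by fun_prop) (g.denom_ne_zero hz)

lemma analyticAt_act (k : ℝ) {f : ℂ → ℂ} {z : ℂ} (hz : ‖z‖ < 1)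
    (hf : AnalyticAt ℂ f (g.moebiusInv z)) : AnalyticAt ℂ (g.act k f) z := by
  refine AnalyticAt.mul (hf.comp (g.analyticAt_moebiusInv hz)) (analyticAt_const.mul ?_)
  exact AnalyticAt.cpow (by fun_prop) analyticAt_const (Or.inl (g.re_factor_pos hz))

lemma eventually_norm_lt_one {z : ℂ} (hz : ‖z‖ < 1) : ∀ᶠ w in 𝓝 z, ‖w‖ < 1 :=
  continuous_norm.continuousAt.eventually (gt_mem_nhds hz)

/-- Acting by the inverse carries regularity back. Thus regularity of gφ at 0 becomes regularity of
φ at the point that `moebiusInv` assigns to 0. -/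
lemma analyticAt_moebiusInv_of_act (k : ℝ) {f : ℂ → ℂ} {z : ℂ} (hz : ‖z‖ < 1)
    (hf : AnalyticAt ℂ (g.act k f) z) : AnalyticAt ℂ f (g.moebiusInv z) := by
  have hw := g.norm_moebiusInv_lt hz
  have h1 : g⁻¹.moebiusInv (g.moebiusInv z) = z := by
    rw [← moebiusInv_mul _ _ hz, mul_inv_cancel]
    simp [moebiusInv]
  refine (g⁻¹.analyticAt_act k hw (h1.symm ▸ hf)).congr ?_
  filter_upwards [eventually_norm_lt_one hw] with w hw'
  rw [← act_mul _ _ _ _ hw', inv_mul_cancel, act_one]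

lemma act_congr (k : ℝ) {f₁ f₂ : ℂ → ℂ} {z : ℂ} (hz : ‖z‖ < 1)
    (h : f₁ =ᶠ[𝓝 (g.moebiusInv z)] f₂) : g.act k f₁ =ᶠ[𝓝 z] g.act k f₂ := by
  filter_upwards [(g.analyticAt_moebiusInv hz).continuousAt.eventually h] with w hw
  rw [act, act, hw]

end CoverGroup

/-- Identity theorem for meromorphic functions on a preconnected set. -/
lemma eventuallyEq_of_meromorphicOn {U : Set ℂ} (hU : IsPreconnected U) {f g : ℂ → ℂ}
    (hf : MeromorphicOn f U) (hg : MeromorphicOn g U) {x y : ℂ} (hx : x ∈ U) (hy : y ∈ U)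
    (h : f =ᶠ[𝓝 x] g) (hfy : AnalyticAt ℂ f y) (hgy : AnalyticAt ℂ g y) : f =ᶠ[𝓝 y] g := by
  have hord : meromorphicOrderAt (f - g) y = ⊤ := by
    by_contra hne
    refine (hf.sub hg).meromorphicOrderAt_ne_top_of_isPreconnected hU hy hx hne ?_
    rw [meromorphicOrderAt_eq_top_iff]
    refine (h.filter_mono nhdsWithin_le_nhds).mono fun z hz => ?_
    simp [hz]
  rw [meromorphicOrderAt_eq_top_iff] at hord
  -- Infinite order gives vanishing only on a punctured neighbourhood; analyticity at `y` fills in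
  -- the point.
  have := (hfy.sub hgy).frequently_zero_iff_eventually_zero.1 hord.frequently
  filter_upwards [this] with z hz
  simpa [sub_eq_zero] using hz

namespace FormalDifferential

variable {k m n : ℝ}

/-- Equal Taylor series give equal germs at 0. The identity theorem continues this to the preimage
of 0, and the germ there determines the translate. -/
theorem IsTranslate.unique {g : CoverGroup} {F F₁ F₂ : FormalDifferential k}
    (h₁ : IsTranslate g F F₁) (h₂ : IsTranslate g F F₂) : F₁ = F₂ := by
  obtain ⟨φ, hφ, hφ0, hφF, hgφ, rfl⟩ := h₁
  obtain ⟨ψ, hψ, hψ0, hψF, hgψ, rfl⟩ := h₂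
  have h0 : ‖(0 : ℂ)‖ < 1 := by simp
  refine taylor_congr (g.act_congr k h0 ?_)
  exact eventuallyEq_of_meromorphicOn (convex_ball 0 1).isPreconnected hφ hψ
    (Metric.mem_ball_self one_pos) (mem_ball_zero_iff.2 (g.norm_moebiusInv_lt h0))
    (eventuallyEq_of_taylor_eq hφ0 hψ0 (hφF.trans hψF.symm))
    (g.analyticAt_moebiusInv_of_act k h0 hgφ) (g.analyticAt_moebiusInv_of_act k h0 hgψ)

/-- The formal quotient of two holomorphic differentials. -/
def holQuot (p : HolDifferential m × HolDifferential n) : FormalDifferential (m - n) :=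
  (taylor m (extendZero p.1)).quot (taylor n (extendZero p.2))

lemma analyticAt_extendZero (θ : HolDifferential m) {z : ℂ} (hz : ‖z‖ < 1) :
    AnalyticAt ℂ (extendZero θ) z :=
  θ.holo.analyticAt (Metric.isOpen_ball.mem_nhds (mem_ball_zero_iff.2 hz))

theorem isTranslate_holQuot (g : CoverGroup) (p : HolDifferential m × HolDifferential n)
    (h : p.2 0 ≠ 0) (hg : (g • p.2) 0 ≠ 0) : IsTranslate g (holQuot p) (holQuot (g • p)) := by
  have h0 : ‖(0 : ℂ)‖ < 1 := by simp
  have e0 (θ : HolDifferential n) : extendZero θ 0 = θ 0 := by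
    rw [extendZero_of_lt _ h0]; rfl
  have hact : g.act (m - n) (extendZero p.1 / extendZero p.2) =ᶠ[𝓝 0]
      extendZero (g • p.1 : HolDifferential m) / extendZero (g • p.2 : HolDifferential n) := by
    filter_upwards [CoverGroup.eventually_norm_lt_one h0] with z hz
    have hf := HolDifferential.factor_sub g m n (.mk z hz)
    rw [Complex.UnitDisc.coe_mk] at hf
    rw [Pi.div_apply, extendZero_of_lt (g • p.1 : HolDifferential m) hz, extendZero_of_lt (g • p.2 : HolDifferential n) hz,
      HolDifferential.smul_apply, HolDifferential.smul_apply]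
    simp only [CoverGroup.act, Complex.UnitDisc.coe_mk, Pi.div_apply, hf]
    rw [div_mul_div_comm]
  have hgan : AnalyticAt ℂ (extendZero (g • p.1 : HolDifferential m) / extendZero (g • p.2 : HolDifferential n)) 0 :=
    (analyticAt_extendZero _ h0).div (analyticAt_extendZero _ h0) (by rwa [e0])
  refine ⟨extendZero p.1 / extendZero p.2, fun z hz => ?_, ?_, ?_, ?_, ?_⟩
  · rw [mem_ball_zero_iff] at hz
    exact (analyticAt_extendZero _ hz).meromorphicAt.div (analyticAt_extendZero _ hz).meromorphicAt
  · exact (analyticAt_extendZero _ h0).div (analyticAt_extendZero _ h0) (by rwa [e0])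
  · exact taylor_div (analyticAt_extendZero _ h0) (analyticAt_extendZero _ h0) (by rwa [e0])
  · exact hgan.congr hact.symm
  · rw [taylor_congr hact]
    exact taylor_div (analyticAt_extendZero _ h0) (analyticAt_extendZero _ h0) (by rwa [e0])

lemma continuous_iteratedDeriv (i : ℕ) :
    Continuous fun θ : HolDifferential m => iteratedDeriv i (extendZero θ) 0 := by
  refine continuous_iff_continuousAt.2 fun θ => ?_
  have h0 : TendstoLocallyUniformlyOn (fun η : HolDifferential m => extendZero η) (extendZero θ)
      (𝓝 θ) (Metric.ball 0 1) :=
    tendstoLocallyUniformlyOn_extendZero (ContinuousMap.tendsto_iff_tendstoLocallyUniformly.1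
      (continuous_subtype_val.tendsto θ))
  have hdiff (i : ℕ) (η : HolDifferential m) :
      DifferentiableOn ℂ (iteratedDeriv i (extendZero η)) (Metric.ball 0 1) := by
    induction i with
    | zero => rw [iteratedDeriv_zero]; exact η.holo
    | succ i ih => rw [iteratedDeriv_succ]; exact ih.deriv Metric.isOpen_ball
  have h (i : ℕ) : TendstoLocallyUniformlyOn
      (fun η : HolDifferential m => iteratedDeriv i (extendZero η))
      (iteratedDeriv i (extendZero θ)) (𝓝 θ) (Metric.ball 0 1) := by
    induction i with
    | zero => simpa using h0
    | succ i ih =>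
      simp only [iteratedDeriv_succ]
      exact ih.deriv (Eventually.of_forall (hdiff i)) Metric.isOpen_ball
  exact (h i).tendsto_at (Metric.mem_ball_self one_pos)

lemma measurable_coeff_taylor (i : ℕ) :
    Measurable fun θ : HolDifferential m => (taylor m (extendZero θ)).coeff i := by
  simp only [coeff, toPowerSeries, taylor, PowerSeries.coeff_mk]
  exact (continuous_iteratedDeriv i).measurable.div_const _

/-- The coefficients of the inverse series satisfy a recursion in those of lower index, so strong
induction gives their measurability. -/
theorem measurable_holQuot :
    Measurable (holQuot : HolDifferential m × HolDifferential n → FormalDifferential (m - n)) := by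
  have hinv (i : ℕ) : Measurable fun θ : HolDifferential n =>
      PowerSeries.coeff i (taylor n (extendZero θ)).toPowerSeries⁻¹ := by
    induction i using Nat.strong_induction_on with
    | _ i ih =>
      have hc : Measurable fun θ : HolDifferential n =>
          (PowerSeries.constantCoeff (taylor n (extendZero θ)).toPowerSeries)⁻¹ := by
        simp only [← PowerSeries.coeff_zero_eq_constantCoeff_apply]
        exact (measurable_coeff_taylor 0).inv
      have e (θ : HolDifferential n) := PowerSeries.coeff_inv i (taylor n (extendZero θ)).toPowerSeries
      simp_rw [e]
      by_cases hi : i = 0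
      · simpa only [if_pos hi] using hc
      · simp only [if_neg hi]
        refine hc.neg.mul (Finset.measurable_sum _ fun x _ => ?_)
        by_cases hx : x.2 < i
        · simp only [if_pos hx]
          exact (measurable_coeff_taylor x.1).mul (ih _ hx)
        · simp only [if_neg hx]
          exact measurable_const
  refine measurable_of_coeff fun i => ?_
  have : (fun p : HolDifferential m × HolDifferential n => (holQuot p).coeff i) = fun p =>
      ∑ x ∈ Finset.HasAntidiagonal.antidiagonal i, (taylor m (extendZero p.1)).coeff x.1 *
        PowerSeries.coeff x.2 (taylor n (extendZero p.2)).toPowerSeries⁻¹ :=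
    funext fun p => PowerSeries.coeff_mul i _ _
  rw [this]
  exact Finset.measurable_sum _ fun x _ =>
    ((measurable_coeff_taylor x.1).comp measurable_fst).mul ((hinv x.2).comp measurable_snd)

open Classical in
/-- There is a measurable map that translates the formal quotients of holomorphic differentials. -/
theorem exists_measurable_translate (g : CoverGroup) (m n : ℝ) :
    ∃ T : FormalDifferential (m - n) → FormalDifferential (m - n), Measurable T ∧
      ∀ p : HolDifferential m × HolDifferential n, p.2 0 ≠ 0 → (g • p.2) 0 ≠ 0 →
        T (holQuot p) = holQuot (g • p) := by
  set P : Set (HolDifferential m × HolDifferential n) := {p | p.2 0 ≠ 0 ∧ (g • p.2) 0 ≠ 0} with hP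
  have heval : Measurable fun θ : HolDifferential n => θ 0 :=
    (HolDifferential.continuous_eval continuous_id continuous_const).measurable
  have hPm : MeasurableSet P := by
    refine MeasurableSet.inter ?_ ?_
    · exact (heval.comp measurable_snd) (measurableSet_singleton 0).compl
    · exact (heval.comp ((measurable_const_smul g).comp measurable_snd))
        (measurableSet_singleton 0).compl
  have := hPm.standardBorel
  let T₀ : FormalDifferential (m - n) → FormalDifferential (m - n) := fun F =>
    if h : ∃ F', IsTranslate g F F' then h.choose else F
  have hT₀ (p : HolDifferential m × HolDifferential n) (hp : p ∈ P) :
      T₀ (holQuot p) = holQuot (g • p) := by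
    have h := isTranslate_holQuot g p hp.1 hp.2
    have hex : ∃ F', IsTranslate g (holQuot p) F' := ⟨_, h⟩
    simp only [T₀, dif_pos hex]
    exact hex.choose_spec.unique h
  let q : P → FormalDifferential (m - n) := fun p => holQuot p.1
  have hq : Measurable q := measurable_holQuot.comp measurable_subtype_coe
  have hcomp : T₀ ∘ q = fun p : P => holQuot (g • p.1) := funext fun p => hT₀ p.1 p.2
  have hm : Measurable (T₀ ∘ q) := by
    rw [hcomp]
    refine measurable_holQuot.comp (Measurable.prodMk ?_ ?_)
    · exact (measurable_const_smul g).comp (measurable_fst.comp measurable_subtype_coe)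
    · exact (measurable_const_smul g).comp (measurable_snd.comp measurable_subtype_coe)
  -- `T₀` is defined by choice, but its composition with `q` is measurable, and on standard Borel
  -- spaces this descends to the range of `q`. The restriction is then extended to a measurable map
  -- on the whole space.
  have hr := (hq.measurable_comp_iff_restrict (g := T₀)).1 hm
  have : Nonempty (FormalDifferential (m - n)) := ⟨(0 : PowerSeries ℂ)⟩
  obtain ⟨T, hT, hTeq⟩ := Measurable.exists_eq_measurable_comp
    (f := (Subtype.val : Set.range q → FormalDifferential (m - n))) hr
  refine ⟨T, hT, fun p h hg => ?_⟩
  have := congrFun hTeq ⟨holQuot p, ⟨⟨p, h, hg⟩, rfl⟩⟩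
  rw [← hT₀ p ⟨h, hg⟩]
  exact this.symm

end FormalDifferential

open FormalDifferential in
theorem IsErgodicInvariant.formalQuotImage {m n : ℝ} {ν : Measure (HolDifferential m)}
    {μ : Measure (HolDifferential n)} (hν : IsErgodicInvariant ν) (hμ : IsErgodicInvariant μ)
    (h0 : ∀ᵐ θ ∂μ, θ 0 ≠ 0) : IsFormalErgodicInvariant (formalQuotImage ν μ) := by
  have := hν.isProbabilityMeasure
  have := hμ.isProbabilityMeasure
  have := hν.ergodicSMul
  have := hμ.ergodicSMul
  have hprod := hν.ergodicSMul_prod hμ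
  have hq := measurable_holQuot (m := m) (n := n)
  have hρ : ConformalMeasures.formalQuotImage ν μ = (ν.prod μ).map holQuot := rfl
  have hP : ∀ᵐ p ∂ν.prod μ, p.2 0 ≠ 0 :=
    (Measure.quasiMeasurePreserving_snd (μ := ν) (ν := μ)).ae h0
  have hgP (g : CoverGroup) : ∀ᵐ p ∂ν.prod μ, (g • p.2) 0 ≠ 0 :=
    (Measure.quasiMeasurePreserving_snd (μ := ν) (ν := μ)).ae
      ((measurePreserving_smul g μ).quasiMeasurePreserving.ae h0)
  have hmp (g : CoverGroup) : MeasurePreserving (g • · : HolDifferential m × HolDifferential n → _)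
      (ν.prod μ) (ν.prod μ) :=
    (measurePreserving_smul g ν).prod (measurePreserving_smul g μ)
  rw [hρ]
  refine ⟨Measure.isProbabilityMeasure_map hq.aemeasurable, fun g => ?_, fun E hE hinv => ?_⟩
  · obtain ⟨T, hT, hTq⟩ := exists_measurable_translate g m n
    have hTae : ∀ᵐ p ∂ν.prod μ, T (holQuot p) = holQuot (g • p) := by
      filter_upwards [hP, hgP g] with p h1 h2 using hTq p h1 h2
    refine ⟨T, ⟨hT, ?_⟩, ?_⟩
    · rw [Measure.map_map hT hq, Measure.map_congr (f := T ∘ holQuot) (g := holQuot ∘ (g • ·)) hTae,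
        ← Measure.map_map hq (hmp g).measurable, (hmp g).map_eq]
    -- Measurability of the translate relation is not available, so the transfer must allow
    -- arbitrary predicates.
    · refine ae_map_of_ae_comp hq ?_
      filter_upwards [hP, hgP g] with p h1 h2
      rw [hTq p h1 h2]
      exact isTranslate_holQuot g p h1 h2
  -- The preimage of `E` is almost invariant for the genuine action on pairs, where ergodicity of
  -- the product applies.
  · have hconst := hprod.aeconst_of_forall_preimage_smul_ae_eq (hq hE) fun g => by
      have h := ae_of_ae_map hq.aemeasurable (hinv g)
      refine eventuallyEq_set.2 ?_
      filter_upwards [hP, hgP g, h] with p h1 h2 h3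
      exact h3 _ (isTranslate_holQuot g p h1 h2)
    rw [eventuallyConst_set] at hconst
    rw [Measure.map_apply hq hE, Measure.map_apply hq hE.compl]
    refine hconst.symm.imp (fun h => ?_) fun h => ?_
    · exact measure_eq_zero_iff_ae_notMem.2 h
    · exact measure_eq_zero_iff_ae_notMem.2 (h.mono fun p hp hc => hc hp)

end ConformalMeasures

end

theorem mainTheorem9 :
    (∀ (m : ℝ) (ν μ : Measure (HolDifferential m)),
      IsErgodicInvariant ν → IsErgodicInvariant μ → IsErgodicInvariant (ν.conv μ)) ∧
    (∀ (m n : ℝ) (ν : Measure (HolDifferential m)) (μ : Measure (HolDifferential n)),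
      IsErgodicInvariant ν → IsErgodicInvariant μ →
        IsErgodicInvariant (mulImage ν μ) ∧
        ((∀ᵐ θ ∂μ, ∀ z, θ z ≠ 0) → IsErgodicInvariant (quotImage ν μ)) ∧
        ((∀ᵐ θ ∂μ, θ 0 ≠ 0) → IsFormalErgodicInvariant (formalQuotImage ν μ))) :=
  ⟨fun _ _ _ hν hμ => hν.conv hμ, fun _ _ _ _ hν hμ =>
    ⟨hν.mulImage hμ, fun _ => hν.quotImage hμ, fun h => hν.formalQuotImage hμ h⟩⟩
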